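/- Let $(V,\langle\cdot,\cdot\rangle)$ be a $4$-dimensional real vector space with a non-degenerate symmetric bilinear form of signature $(2,2)$, and let $A\in\otimes^4V^*$ be an algebraic curvature tensor on $V$, i.e. $$A(x,y,z,v)=-A(y,x,z,v)=A(z,v,x,y),\qquad A(x,y,z,v)+A(y,z,x,v)+A(z,x,y,v)=0 .$$ The Jacobi operator $\mathcal J_A(x)$ is defined by $\langle\mathcal J_A(x)y,z\rangle=A(y,x,x,z)$. The model $\mathfrak M=(V,\langle\cdot,\cdot\rangle,A)$ is *null Jordan Osserman* if the Jordan normal form of $\mathcal J_A(v)$ is the same for all non-zero null vectors $v$ (those with $\langle v,v\rangle=0$). The tensor $A$ is of *Type Ia* if the Jordan normal form of $\mathcal J_A(x)$ restricted to $x^\perp$ is constant on the spacelike unit vectors ($\langle x,x\rangle=1$) and constant on the timelike unit vectors ($\langle x,x\rangle=-1$), and is in both cases a real diagonal matrix. Put $$A^0(x,y,z,v)=\langle y,z\rangle\langle x,v\rangle-\langle x,z\rangle\langle y,v\rangle,$$ and, for a skew-adjoint endomorphism $\Psi$ of $V$, $$A^\Psi(x,y,z,v)=\langle\Psi y,z\rangle\langle\Psi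 x,v\rangle-\langle\Psi x,z\rangle\langle\Psi y,v\rangle-2\langle\Psi x,y\rangle\langle\Psi z,v\rangle .$$ **Theorem.** $\mathfrak M$ is null Jordan Osserman if and only if $A$ is of Type Ia and one of the following holds: 1. There is a real constant $\kappa_0$ with $A=\kappa_0A^0$. 2. There are real constants $\kappa_0$ and $\kappa_J\neq0$ with $A=\kappa_0A^0+\kappa_JA^J$, where $J$ is an orthogonal complex structure on $V$ (a skew-adjoint endomorphism with $J^2=-\mathrm{id}$). 3. There is a real constant $\kappa_P\neq0$ with $A=\kappa_PA^P$, where $P$ is an adapted paracomplex structure on $V$ (a skew-adjoint endomorphism with $P^2=\mathrm{id}$). 4. There are real constants $\kappa_1,\kappa_2,\kappa_3$ with $\kappa_2\kappa_3(\kappa_2+\kappa_1)(\kappa_3+\kappa_1)>0$, such that $3\kappa_1,-3\kappa_2,-3\kappa_3$ are pairwise distinct, and $A=\kappa_1A^{\Psi_1}+\kappa_2A^{\Psi_2}+\kappa_3A^{\Psi_3}$, where $(\Psi_1,\Psi_2,\Psi_3)$ is a paraquaternionic structure on $V$ (skew-adjoint endomorphisms with $\Psi_1^2=-\mathrm{id}$,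 $\Psi_2^2=\Psi_3^2=\mathrm{id}$ and $\Psi_i\Psi_j+\Psi_j\Psi_i=0$ for $i\neq j$). -/

import Mathlib

noncomputable section

namespace NullOsserman

/-- Covariant `4`-tensors on `V`, i.e. elements of `⊗⁴ V*`. -/
abbrev Tensor4 (V : Type*) [AddCommGroup V] [Module ℝ V] : Type _ :=
  V →ₗ[ℝ] V →ₗ[ℝ] V →ₗ[ℝ] V →ₗ[ℝ] ℝ

/-- Algebraic curvature tensors: `4`-tensors with the symmetries of the Riemann curvature tensor. -/
structure IsAlgebraicCurvatureTensor {V : Type*} [AddCommGroup V] [Module ℝ V]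
    (A : Tensor4 V) : Prop where
  skew : ∀ x y z v, A x y z v = -A y x z v
  pair : ∀ x y z v, A x y z v = A z v x y
  bianchi : ∀ x y z v, A x y z v + A y z x v + A z x y v = 0

/-- A model `(V, ⟨·,·⟩, A)`: a non-degenerate symmetric bilinear form and an algebraic
curvature tensor on a real vector space. -/
structure Model (V : Type*) [AddCommGroup V] [Module ℝ V] where
  /-- the inner product `⟨·,·⟩` -/
  form : LinearMap.BilinForm ℝ V
  form_symm : form.IsSymm
  form_nondegenerate : form.Nondegenerate
  /-- the curvature tensor `A` -/
  curv : Tensor4 V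
  curv_isCurvature : IsAlgebraicCurvatureTensor curv

/-- The tensor `A⁰(x,y,z,v) = ⟨y,z⟩⟨x,v⟩ - ⟨x,z⟩⟨y,v⟩` of constant sectional curvature `+1`. -/
def constCurv {V : Type*} [AddCommGroup V] [Module ℝ V] (g : LinearMap.BilinForm ℝ V) :
    Tensor4 V :=
  LinearMap.mk₂ ℝ
    (fun x y => LinearMap.mk₂ ℝ (fun z v => g y z * g x v - g x z * g y v)
      (by intros; simp; ring) (by intros; simp; ring)
      (by intros; simp; ring) (by intros; simp; ring))
    (by intros; ext; simp; ring) (by intros; ext; simp; ring)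
    (by intros; ext; simp; ring) (by intros; ext; simp; ring)

/-- The tensor
`A^Ψ(x,y,z,v) = ⟨Ψy,z⟩⟨Ψx,v⟩ - ⟨Ψx,z⟩⟨Ψy,v⟩ - 2⟨Ψx,y⟩⟨Ψz,v⟩` of an endomorphism `Ψ`. -/
def endoCurv {V : Type*} [AddCommGroup V] [Module ℝ V] (g : LinearMap.BilinForm ℝ V)
    (Ψ : V →ₗ[ℝ] V) : Tensor4 V :=
  LinearMap.mk₂ ℝ
    (fun x y => LinearMap.mk₂ ℝ
      (fun z v => g (Ψ y) z * g (Ψ x) v - g (Ψ x) z * g (Ψ y) v - 2 * g (Ψ x) y * g (Ψ z) v)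
      (by intros; simp; ring) (by intros; simp; ring)
      (by intros; simp; ring) (by intros; simp; ring))
    (by intros; ext; simp; ring) (by intros; ext; simp; ring)
    (by intros; ext; simp; ring) (by intros; ext; simp; ring)

/-- `Ψ` is an orthogonal complex structure: skew-adjoint with `Ψ² = -id`. -/
def IsOrthogonalComplex {V : Type*} [AddCommGroup V] [Module ℝ V]
    (g : LinearMap.BilinForm ℝ V) (Ψ : V →ₗ[ℝ] V) : Prop :=
  g.IsSkewAdjoint Ψ ∧ Ψ ∘ₗ Ψ = -LinearMap.id

/-- `Ψ` is an adapted paracomplex structure: skew-adjoint with `Ψ² = id`. -/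
def IsAdaptedParacomplex {V : Type*} [AddCommGroup V] [Module ℝ V]
    (g : LinearMap.BilinForm ℝ V) (Ψ : V →ₗ[ℝ] V) : Prop :=
  g.IsSkewAdjoint Ψ ∧ Ψ ∘ₗ Ψ = LinearMap.id

/-- `(Ψ₁, Ψ₂, Ψ₃)` is a paraquaternionic structure: skew-adjoint, `Ψ₁² = -id`,
`Ψ₂² = Ψ₃² = id`, and pairwise anti-commuting. -/
structure IsParaquaternionic {V : Type*} [AddCommGroup V] [Module ℝ V]
    (g : LinearMap.BilinForm ℝ V) (Ψ₁ Ψ₂ Ψ₃ : V →ₗ[ℝ] V) : Prop where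
  complex₁ : IsOrthogonalComplex g Ψ₁
  para₂ : IsAdaptedParacomplex g Ψ₂
  para₃ : IsAdaptedParacomplex g Ψ₃
  anti₁₂ : Ψ₁ ∘ₗ Ψ₂ + Ψ₂ ∘ₗ Ψ₁ = 0
  anti₁₃ : Ψ₁ ∘ₗ Ψ₃ + Ψ₃ ∘ₗ Ψ₁ = 0
  anti₂₃ : Ψ₂ ∘ₗ Ψ₃ + Ψ₃ ∘ₗ Ψ₂ = 0

/-- Two endomorphisms of a finite dimensional space have the same Jordan normal form, that is,
they are conjugate. -/
def SameJordanForm {V : Type*} [AddCommGroup V] [Module ℝ V] (S T : V →ₗ[ℝ] V) : Prop :=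
  ∃ φ : V ≃ₗ[ℝ] V, (φ : V →ₗ[ℝ] V) ∘ₗ S = T ∘ₗ (φ : V →ₗ[ℝ] V)

namespace Model

/-- Signature `(p, q)`: `p` timelike (negative) and `q` spacelike (positive) directions. -/
def HasSignature {V : Type*} [AddCommGroup V] [Module ℝ V] (M : Model V) (p q : ℕ) : Prop :=
  sigNeg (LinearMap.BilinMap.toQuadraticMap M.form) = p ∧
    sigPos (LinearMap.BilinMap.toQuadraticMap M.form) = q

/-- The set of spacelike unit vectors. -/
def spacelikeSphere {V : Type*} [AddCommGroup V] [Module ℝ V] (M : Model V) : Set V :=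
  {x | M.form x x = 1}

/-- The set of timelike unit vectors. -/
def timelikeSphere {V : Type*} [AddCommGroup V] [Module ℝ V] (M : Model V) : Set V :=
  {x | M.form x x = -1}

/-- The null cone: the set of non-zero null vectors. -/
def nullCone {V : Type*} [AddCommGroup V] [Module ℝ V] (M : Model V) : Set V :=
  {x | x ≠ 0 ∧ M.form x x = 0}

/-- The Jacobi operator `𝒥_A(x)`, characterized by `⟨𝒥_A(x) y, z⟩ = A(y, x, x, z)`
(see `form_jacobi`). -/
def jacobi {V : Type*} [AddCommGroup V] [Module ℝ V] [FiniteDimensional ℝ V]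
    (M : Model V) (x : V) : V →ₗ[ℝ] V :=
  (M.form.toDual M.form_nondegenerate).symm.toLinearMap ∘ₗ ((M.curv.flip x).flip x)

theorem form_jacobi {V : Type*} [AddCommGroup V] [Module ℝ V] [FiniteDimensional ℝ V]
    (M : Model V) (x y z : V) : M.form (M.jacobi x y) z = M.curv y x x z := by
  simp [jacobi]

/-- The orthogonal complement `x^⊥`. -/
def perp {V : Type*} [AddCommGroup V] [Module ℝ V] (M : Model V) (x : V) : Submodule ℝ V :=
  LinearMap.ker (M.form x)

theorem jacobi_mem_perp {V : Type*} [AddCommGroup V] [Module ℝ V] [FiniteDimensional ℝ V]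
    (M : Model V) (x y : V) : M.jacobi x y ∈ M.perp x := by
  have h1 : M.form x (M.jacobi x y) = M.curv y x x x := by
    rw [← M.form_jacobi x y x]; exact M.form_symm.eq _ _
  have h2 := M.curv_isCurvature.pair y x x x
  have h3 := M.curv_isCurvature.skew x x y x
  rw [perp, LinearMap.mem_ker, h1]
  linarith

/-- The Jacobi operator `𝒥_A(x)` restricted to `x^⊥`. -/
def jacobiPerp {V : Type*} [AddCommGroup V] [Module ℝ V] [FiniteDimensional ℝ V]
    (M : Model V) (x : V) : M.perp x →ₗ[ℝ] M.perp x :=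
  (M.jacobi x).restrict (fun y _ => M.jacobi_mem_perp x y)

/-- `M` is null Jordan Osserman: the Jordan normal form of the Jacobi operator is constant on the
null cone. -/
def IsNullJordanOsserman {V : Type*} [AddCommGroup V] [Module ℝ V] [FiniteDimensional ℝ V]
    (M : Model V) : Prop :=
  ∀ v ∈ M.nullCone, ∀ w ∈ M.nullCone, SameJordanForm (M.jacobi v) (M.jacobi w)

/-- On the set `S` of unit vectors, the Jordan normal form of `𝒥_A(x)` restricted to `x^⊥` is
constant and equal to `diag(α, β, γ)` for some real `α`, `β`, `γ`. -/
def IsDiagonalOn {V : Type*} [AddCommGroup V] [Module ℝ V] [FiniteDimensional ℝ V]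
    (M : Model V) (S : Set V) : Prop :=
  ∃ α β γ : ℝ, ∀ x ∈ S, ∃ b : Module.Basis (Fin 3) ℝ (M.perp x),
    LinearMap.toMatrix b b (M.jacobiPerp x) = Matrix.diagonal ![α, β, γ]

/-- `A` is of Type Ia: on the spacelike and on the timelike unit vectors `x`, the Jordan normal
form of `𝒥_A(x)` restricted to `x^⊥` is constant and is a real diagonal matrix. -/
def IsTypeIa {V : Type*} [AddCommGroup V] [Module ℝ V] [FiniteDimensional ℝ V]
    (M : Model V) : Prop :=
  M.IsDiagonalOn M.spacelikeSphere ∧ M.IsDiagonalOn M.timelikeSphere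

end Model

end NullOsserman

end

/-!
Let `A` be null Jordan Osserman. As `J(2v) = 4 J(v)`, the traces of `J(v)` and of `J(v)²` vanish on
the null cone. The first makes `A` Einstein. In null frames the second is a product of curvature
components, and makes one half of the Weyl tensor vanish; the paraquaternionic triple `Ψ` attached
to the other half then gives `A = ∑ mᵢⱼ A^{Ψᵢ, Ψⱼ}` for a symmetric `3 × 3` matrix `m`, the Lorentz
form corresponding to `3 A⁰`.

For null `v` the vectors `Ψᵢ v` span an isotropic plane, and their one linear relation
`(∑ nᵢ Ψᵢ) v = 0` has a null vector `n` of Lorentzian `ℝ³` as coefficients. So `J(v)² = 0`, and the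
Jordan type of `J(v)` is the rank of `m` on the annihilator of `n`. Hence `⟨n, adj(m) n⟩` vanishes
either for no null `n` or for all of them. In the first case it keeps its sign, which makes `m`
diagonal in a Lorentz-orthonormal basis; in the second `m` is a multiple of the Lorentz form or of
rank at most one, and the constancy of the Jordan type makes it diagonal as well. The four families
are read off the eigenvalues, and once `m` is diagonal the vectors `Ψᵢ x` diagonalize `J(x)` for
every unit vector `x`. Conversely, in each family `J(v)` squares to zero for null `v`, and its rank
does not depend on `v`.
-/

open Module Matrix

namespace NullOsserman

variable {V : Type*} [AddCommGroup V] [Module ℝ V]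

/-! ### Jordan normal forms -/

section SquareZero

theorem exists_normalForm_of_comp_self_eq_zero {K W : Type*} [Field K] [AddCommGroup W]
    [Module K W] {N : W →ₗ[K] W} (hN : N ∘ₗ N = 0) :
    ∃ (C : Submodule K (LinearMap.ker N))
      (Θ : ((LinearMap.range N × LinearMap.range N) × C) ≃ₗ[K] W),
      ∀ p, N (Θ p) = Θ ((0, p.1.1), 0) := by
  have hNN : ∀ x, N (N x) = 0 := LinearMap.congr_fun hN
  have hrange : ∀ y : LinearMap.range N, N y = 0 := by rintro ⟨_, x, rfl⟩; exact hNN x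
  obtain ⟨s, hs⟩ := N.rangeRestrict.exists_rightInverse_of_surjective N.range_rangeRestrict
  replace hs : ∀ y, N (s y) = y := fun y => congrArg Subtype.val (LinearMap.congr_fun hs y)
  obtain ⟨C, hC⟩ := ((LinearMap.range N).submoduleOf (LinearMap.ker N)).exists_isCompl
  let Θ : ((LinearMap.range N × LinearMap.range N) × C) →ₗ[K] W :=
    (s.coprod (LinearMap.range N).subtype).coprod ((LinearMap.ker N).subtype ∘ₗ C.subtype)
  have hΘ : ∀ p, Θ p = s p.1.1 + p.1.2 + (p.2 : LinearMap.ker N) := fun p => rfl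
  have hNΘ : ∀ p, N (Θ p) = p.1.1 := fun p => by simp [hΘ, hs, hrange]
  have hinj : Function.Injective Θ := by
    rw [injective_iff_map_eq_zero]
    rintro ⟨⟨y, z⟩, k⟩ h
    obtain rfl : y = 0 := Subtype.ext ((hNΘ ((y, z), k)).symm.trans (by simp [h]))
    have hzk : (⟨z, hrange z⟩ : LinearMap.ker N) + k = 0 := Subtype.ext (by simpa [hΘ] using h)
    have hk : k = 0 := by
      refine Subtype.ext (Submodule.disjoint_def.1 hC.disjoint k ?_ k.2)
      rw [← neg_eq_of_add_eq_zero_right hzk]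
      exact neg_mem (Submodule.mem_comap.2 z.2)
    have hz : z = 0 := Subtype.ext (by simpa [hk] using congrArg Subtype.val hzk)
    rw [hz, hk, Prod.mk_zero_zero, Prod.mk_zero_zero]
  have hsurj : Function.Surjective Θ := by
    intro w
    have hw : w - s (N.rangeRestrict w) ∈ LinearMap.ker N := by simp [hs]
    obtain ⟨z, hz, k, hk, hzk⟩ := Submodule.mem_sup.1
      (hC.sup_eq_top.symm ▸ Submodule.mem_top : (⟨_, hw⟩ : LinearMap.ker N) ∈ _)
    refine ⟨((N.rangeRestrict w, ⟨z, hz⟩), ⟨k, hk⟩), ?_⟩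
    have := congrArg Subtype.val hzk
    simp only [hΘ, add_assoc]
    exact (add_eq_of_eq_sub' this)
  have hNΘ' : ∀ p, N (Θ p) = Θ ((0, p.1.1), 0) := fun p => (hNΘ p).trans (by simp [hΘ])
  exact ⟨C, LinearEquiv.ofBijective Θ ⟨hinj, hsurj⟩, hNΘ'⟩

theorem exists_conj_of_comp_self_eq_zero {K W : Type*} [Field K] [AddCommGroup W]
    [Module K W] [FiniteDimensional K W] {S T : W →ₗ[K] W} (hS : S ∘ₗ S = 0) (hT : T ∘ₗ T = 0)
    (h : finrank K (LinearMap.ker S) = finrank K (LinearMap.ker T)) :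
    ∃ φ : W ≃ₗ[K] W, (φ : W →ₗ[K] W) ∘ₗ S = T ∘ₗ (φ : W →ₗ[K] W) := by
  obtain ⟨C, Θ, hΘ⟩ := exists_normalForm_of_comp_self_eq_zero hS
  obtain ⟨D, Ξ, hΞ⟩ := exists_normalForm_of_comp_self_eq_zero hT
  have hrange : finrank K (LinearMap.range S) = finrank K (LinearMap.range T) := by
    have := S.finrank_range_add_finrank_ker
    have := T.finrank_range_add_finrank_ker
    lia
  have hCD : finrank K C = finrank K D := by
    have := Θ.finrank_eq
    have := Ξ.finrank_eq
    simp only [finrank_prod] at *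
    lia
  let e := LinearEquiv.ofFinrankEq _ _ hrange
  let f := LinearEquiv.ofFinrankEq _ _ hCD
  refine ⟨Θ.symm.trans (((e.prodCongr e).prodCongr f).trans Ξ), LinearMap.ext fun w => ?_⟩
  obtain ⟨p, rfl⟩ := Θ.surjective w
  simp [hΘ, hΞ]

end SquareZero

namespace SameJordanForm

variable {S T : V →ₗ[ℝ] V}

theorem conj_eq (h : SameJordanForm S T) : ∃ φ : V ≃ₗ[ℝ] V, φ.conj S = T := by
  obtain ⟨φ, hφ⟩ := h
  exact ⟨φ, by rw [LinearEquiv.conj_apply, hφ]; ext; simp⟩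

theorem finrank_ker_eq (h : SameJordanForm S T) :
    finrank ℝ (LinearMap.ker S) = finrank ℝ (LinearMap.ker T) := by
  obtain ⟨φ, hφ⟩ := h
  have hker : LinearMap.ker S = (LinearMap.ker T).comap (φ : V →ₗ[ℝ] V) := by
    rw [← LinearMap.ker_comp, ← hφ, LinearEquiv.ker_comp]
  rw [hker]
  exact ((φ.submoduleMap _).trans (LinearEquiv.ofEq _ _
    (Submodule.map_comap_eq_of_surjective φ.surjective _))).finrank_eq

theorem trace_eq (h : SameJordanForm S T) :
    LinearMap.trace ℝ V S = LinearMap.trace ℝ V T := by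
  obtain ⟨φ, rfl⟩ := h.conj_eq
  exact (LinearMap.trace_conj' S φ).symm

theorem comp_self (h : SameJordanForm S T) : SameJordanForm (S ∘ₗ S) (T ∘ₗ T) := by
  obtain ⟨φ, hφ⟩ := h
  exact ⟨φ, by rw [← LinearMap.comp_assoc, hφ, LinearMap.comp_assoc, hφ, LinearMap.comp_assoc]⟩

end SameJordanForm

/-! ### Real eigenvalues and angles -/

theorem exists_isRoot_of_odd_natDegree {p : Polynomial ℝ} (hp : Odd p.natDegree) :
    ∃ t, p.IsRoot t := by
  wlog hlead : 0 ≤ p.leadingCoeff generalizing p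
  · obtain ⟨t, ht⟩ := this (p := -p) (by simpa using hp)
      (by rw [Polynomial.leadingCoeff_neg]; linarith)
    exact ⟨t, by simpa using ht⟩
  have hdeg : 0 < p.degree := Polynomial.natDegree_pos_iff_degree_pos.1 hp.pos
  have htop := p.tendsto_atTop_of_leadingCoeff_nonneg hdeg hlead
  have hbot : Filter.Tendsto (fun t => (p.comp (-Polynomial.X)).eval t) .atTop .atBot := by
    refine Polynomial.tendsto_atBot_of_leadingCoeff_nonpos _ ?_ ?_
    · apply Polynomial.natDegree_pos_iff_degree_pos.1
      simpa [Polynomial.natDegree_comp] using hp.pos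
    · rw [Polynomial.leadingCoeff_comp (by simp)]
      simp [hp.neg_one_pow, hlead]
  obtain ⟨s, hs⟩ := (htop.eventually_ge_atTop 0).exists
  obtain ⟨t, ht⟩ := (hbot.eventually_le_atBot 0).exists
  exact mem_range_of_exists_le_of_exists_ge p.continuous ⟨-t, by simpa using ht⟩ ⟨s, hs⟩

theorem exists_mulVec_eq_smul_of_odd_card {n : Type*} [Fintype n]
    (hn : Odd (Fintype.card n)) (m : Matrix n n ℝ) :
    ∃ (t : ℝ) (x : n → ℝ), x ≠ 0 ∧ m *ᵥ x = t • x := by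
  classical
  obtain ⟨t, ht⟩ := exists_isRoot_of_odd_natDegree (p := m.charpoly)
    (by rwa [m.charpoly_natDegree_eq_dim])
  rw [Polynomial.IsRoot, Matrix.eval_charpoly] at ht
  obtain ⟨x, hx, h⟩ := Matrix.exists_mulVec_eq_zero_iff.2 ht
  rw [Matrix.sub_mulVec, sub_eq_zero, scalar_apply, ← smul_one_eq_diagonal, Matrix.smul_mulVec,
    one_mulVec] at h
  exact ⟨t, x, hx, h.symm⟩

theorem exists_mul_sin_eq_mul_cos (a b : ℝ) :
    ∃ θ : ℝ, a * Real.sin (2 * θ) = b * Real.cos (2 * θ) := by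
  refine ⟨Complex.arg ⟨a, b⟩ / 2, ?_⟩
  have hcos := Complex.norm_mul_cos_arg ⟨a, b⟩
  have hsin := Complex.norm_mul_sin_arg ⟨a, b⟩
  rw [mul_div_cancel₀ _ two_ne_zero]
  dsimp only at hcos hsin
  linear_combination (Complex.arg ⟨a, b⟩).cos * hsin - (Complex.arg ⟨a, b⟩).sin * hcos

theorem exists_mul_sinh_eq_mul_cosh {a b : ℝ} (h : |b| < |a|) :
    ∃ t : ℝ, a * Real.sinh (2 * t) = b * Real.cosh (2 * t) := by
  have ha : a ≠ 0 := abs_pos.1 ((abs_nonneg b).trans_lt h)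
  have hmem : b / a ∈ Set.Ioo (-1) 1 := by
    rw [Set.mem_Ioo, ← abs_lt, abs_div, div_lt_one (abs_pos.2 ha)]
    exact h
  refine ⟨Real.artanh (b / a) / 2, ?_⟩
  have htanh := Real.tanh_artanh hmem
  rw [Real.tanh_eq_sinh_div_cosh, div_eq_div_iff (Real.cosh_pos _).ne' ha] at htanh
  rw [mul_div_cancel₀ _ two_ne_zero]
  linear_combination htanh

/-! ### The Lorentz form on `ℝ³` -/

/-- The Gram matrix of the Lorentz form on `ℝ³`, with the timelike direction of positive sign. -/
def lorentz : Matrix (Fin 3) (Fin 3) ℝ := diagonal ![1, -1, -1]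

/-- The quadratic form of `lorentz`. -/
def lorentzNorm (x : Fin 3 → ℝ) : ℝ := x 0 ^ 2 - x 1 ^ 2 - x 2 ^ 2

/-- The rows of `X` form an orthonormal basis for the Lorentz form. -/
def IsLorentzFrame (X : Matrix (Fin 3) (Fin 3) ℝ) : Prop := X * lorentz * Xᵀ = lorentz

/-- The quadratic form of the adjugate of `m`. Up to a positive factor, `adjForm m n` is the
determinant of the restriction of the quadratic form `m` to the plane annihilated by `n`. -/
def adjForm (m : Matrix (Fin 3) (Fin 3) ℝ) (n : Fin 3 → ℝ) : ℝ := n ⬝ᵥ m.adjugate *ᵥ n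

/-- `m` is non-degenerate on the annihilators of all null lines. -/
def IsNullNondegenerate (m : Matrix (Fin 3) (Fin 3) ℝ) : Prop :=
  ∀ n ≠ 0, lorentzNorm n = 0 → adjForm m n ≠ 0

/-- `m` is diagonal with respect to a basis orthonormal for the Lorentz form. -/
def IsLorentzDiagonalizable (m : Matrix (Fin 3) (Fin 3) ℝ) : Prop :=
  ∃ X κ, IsLorentzFrame X ∧ m = Xᵀ * diagonal κ * X

theorem lorentz_mul_self : lorentz * lorentz = 1 := by
  simp [lorentz, ← diagonal_one, Fin.forall_fin_succ]

theorem lorentz_mulVec_lorentz_mulVec (x : Fin 3 → ℝ) : lorentz *ᵥ lorentz *ᵥ x = x := by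
  rw [mulVec_mulVec, lorentz_mul_self, one_mulVec]

theorem dotProduct_lorentz_mulVec (x : Fin 3 → ℝ) : x ⬝ᵥ lorentz *ᵥ x = lorentzNorm x := by
  simp only [dotProduct, lorentz, lorentzNorm, mulVec_diagonal, Fin.sum_univ_three, cons_val]
  ring

theorem lorentzNorm_smul (t : ℝ) (x : Fin 3 → ℝ) :
    lorentzNorm (t • x) = t ^ 2 * lorentzNorm x := by
  simp only [lorentzNorm, Pi.smul_apply, smul_eq_mul]
  ring

namespace IsLorentzFrame

variable {X Y : Matrix (Fin 3) (Fin 3) ℝ}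

theorem of_rows (h₀₀ : X 0 0 ^ 2 - X 0 1 ^ 2 - X 0 2 ^ 2 = 1)
    (h₁₁ : X 1 0 ^ 2 - X 1 1 ^ 2 - X 1 2 ^ 2 = -1) (h₂₂ : X 2 0 ^ 2 - X 2 1 ^ 2 - X 2 2 ^ 2 = -1)
    (h₀₁ : X 0 0 * X 1 0 - X 0 1 * X 1 1 - X 0 2 * X 1 2 = 0)
    (h₀₂ : X 0 0 * X 2 0 - X 0 1 * X 2 1 - X 0 2 * X 2 2 = 0)
    (h₁₂ : X 1 0 * X 2 0 - X 1 1 * X 2 1 - X 1 2 * X 2 2 = 0) : IsLorentzFrame X := by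
  ext i j
  fin_cases i <;> fin_cases j <;> simp [mul_apply, Fin.sum_univ_three, lorentz] <;> linarith

theorem one : IsLorentzFrame 1 := by
  simp [IsLorentzFrame]

theorem mul (hX : IsLorentzFrame X) (hY : IsLorentzFrame Y) : IsLorentzFrame (Y * X) := by
  calc Y * X * lorentz * (Y * X)ᵀ = Y * (X * lorentz * Xᵀ) * Yᵀ := by
        simp only [transpose_mul, Matrix.mul_assoc]
    _ = lorentz := by rw [hX, hY]

theorem isUnit (hX : IsLorentzFrame X) : IsUnit X :=
  IsUnit.of_mul_eq_one (lorentz * Xᵀ * lorentz) (by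
    rw [← Matrix.mul_assoc, ← Matrix.mul_assoc, hX, lorentz_mul_self])

theorem isUnit_transpose (hX : IsLorentzFrame X) : IsUnit Xᵀ :=
  (Matrix.isUnit_transpose X).2 hX.isUnit

theorem transpose_mul_lorentz_mul (hX : IsLorentzFrame X) : Xᵀ * lorentz * X = lorentz := by
  have h : X * (lorentz * Xᵀ * lorentz) = 1 := by
    rw [← Matrix.mul_assoc, ← Matrix.mul_assoc, hX, lorentz_mul_self]
  calc Xᵀ * lorentz * X = lorentz * ((lorentz * Xᵀ * lorentz) * X) := by
        simp only [← Matrix.mul_assoc, lorentz_mul_self, Matrix.one_mul]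
    _ = lorentz := by rw [mul_eq_one_comm.1 h, Matrix.mul_one]

theorem exists_congr_eq (hX : IsLorentzFrame X) {m : Matrix (Fin 3) (Fin 3) ℝ} (hm : m.IsSymm) :
    ∃ m', m'.IsSymm ∧ m = Xᵀ * m' * X := by
  have hdet := (isUnit_iff_isUnit_det X).1 hX.isUnit
  have hdet' := (isUnit_iff_isUnit_det Xᵀ).1 hX.isUnit_transpose
  refine ⟨Xᵀ⁻¹ * m * X⁻¹, ?_, ?_⟩
  · rw [IsSymm, transpose_mul, transpose_mul, hm, transpose_nonsing_inv, transpose_nonsing_inv,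
      transpose_transpose, Matrix.mul_assoc]
  · rw [← Matrix.mul_assoc, nonsing_inv_mul_cancel_right _ _ hdet, ← Matrix.mul_assoc,
      mul_nonsing_inv _ hdet', Matrix.one_mul]

theorem lorentzNorm_transpose_mulVec (hX : IsLorentzFrame X) (n : Fin 3 → ℝ) :
    lorentzNorm (Xᵀ *ᵥ n) = lorentzNorm n := by
  rw [← dotProduct_lorentz_mulVec, ← dotProduct_lorentz_mulVec, mulVec_transpose,
    ← dotProduct_mulVec, ← mulVec_transpose, mulVec_mulVec, mulVec_mulVec, hX]

end IsLorentzFrame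

theorem adjForm_congr (X m : Matrix (Fin 3) (Fin 3) ℝ) (n : Fin 3 → ℝ) :
    adjForm (Xᵀ * m * X) (Xᵀ *ᵥ n) = X.det ^ 2 * adjForm m n := by
  have h : (Xᵀ).adjugate *ᵥ Xᵀ *ᵥ n = X.det • n := by
    rw [mulVec_mulVec, adjugate_mul, det_transpose, smul_mulVec, one_mulVec]
  rw [adjForm, adjugate_mul_distrib, adjugate_mul_distrib, ← mulVec_mulVec, ← mulVec_mulVec, h,
    dotProduct_mulVec, ← mulVec_transpose, adjugate_transpose, h, adjForm]
  simp only [mulVec_smul, dotProduct_smul, smul_dotProduct, smul_eq_mul]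
  ring

theorem IsLorentzFrame.isNullNondegenerate {X m : Matrix (Fin 3) (Fin 3) ℝ}
    (hX : IsLorentzFrame X) (h : IsNullNondegenerate (Xᵀ * m * X)) : IsNullNondegenerate m := by
  intro n hn hnull h0
  refine h (Xᵀ *ᵥ n) (fun h1 => hn ?_) (by rw [hX.lorentzNorm_transpose_mulVec, hnull]) ?_
  · exact mulVec_injective_of_isUnit hX.isUnit_transpose (by rw [h1, mulVec_zero])
  · rw [adjForm_congr, h0, mul_zero]

theorem adjForm_eq_zero_iff {m : Matrix (Fin 3) (Fin 3) ℝ} {n : Fin 3 → ℝ} (hn : n ≠ 0) :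
    adjForm m n = 0 ↔ ∃ u ≠ 0, u ⬝ᵥ n = 0 ∧ ∃ μ : ℝ, m *ᵥ u = μ • n := by
  let B : Matrix (Fin 4) (Fin 4) ℝ := !![0, n 0, n 1, n 2; n 0, m 0 0, m 0 1, m 0 2;
    n 1, m 1 0, m 1 1, m 1 2; n 2, m 2 0, m 2 1, m 2 2]
  have hdet : B.det = -adjForm m n := by
    simp [B, adjForm, det_succ_row_zero, Fin.sum_univ_succ, adjugate_fin_three, dotProduct, mulVec,
      Fin.succAbove, submatrix]
    ring
  have hB : ∀ μ u, B *ᵥ vecCons (-μ) u = 0 ↔ u ⬝ᵥ n = 0 ∧ m *ᵥ u = μ • n := by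
    intro μ u
    simp only [B, funext_iff, Fin.forall_fin_succ, mulVec, dotProduct, Fin.sum_univ_succ, of_apply,
      cons_val_zero, cons_val_one, cons_val, cons_val_succ, cons_val_fin_one, Pi.zero_apply,
      Pi.smul_apply, smul_eq_mul, Finset.univ_unique, Finset.sum_singleton, Fin.default_eq_zero,
      Fin.succ_zero_eq_one, Fin.succ_one_eq_two, IsEmpty.forall_iff, and_true]
    grind
  rw [← neg_eq_zero, ← hdet, ← exists_mulVec_eq_zero_iff]
  constructor
  · rintro ⟨w, hw, h⟩
    obtain ⟨μ, u, rfl⟩ : ∃ μ u, w = vecCons (-μ) u :=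
      ⟨-w 0, vecTail w, by rw [neg_neg]; exact (cons_head_tail w).symm⟩
    obtain ⟨hun, hmu⟩ := (hB μ u).1 h
    refine ⟨u, ?_, hun, μ, hmu⟩
    rintro rfl
    have hμ : μ = 0 := by simpa [hn] using hmu.symm
    exact hw (by simp [hμ])
  · rintro ⟨u, hu, hun, μ, hmu⟩
    refine ⟨vecCons (-μ) u, fun h => hu ?_, (hB μ u).2 ⟨hun, hmu⟩⟩
    simpa using congrArg vecTail h

theorem exists_isLorentzFrame_of_timelike {x : Fin 3 → ℝ} (hx : lorentzNorm x = 1) :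
    ∃ X, IsLorentzFrame X ∧ X 0 = x := by
  rw [lorentzNorm] at hx
  rcases eq_or_ne (x 1 ^ 2 + x 2 ^ 2) 0 with h0 | h0
  · have h1 : x 1 = 0 := by nlinarith [sq_nonneg (x 1), sq_nonneg (x 2)]
    have h2 : x 2 = 0 := by nlinarith [sq_nonneg (x 1), sq_nonneg (x 2)]
    refine ⟨of ![x, ![0, 1, 0], ![0, 0, 1]], ?_, rfl⟩
    refine .of_rows hx ?_ ?_ ?_ ?_ ?_ <;> simp [h1, h2]
  · have hpos : 0 < x 1 ^ 2 + x 2 ^ 2 := by positivity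
    set ρ := √(x 1 ^ 2 + x 2 ^ 2)
    have hρ : 0 < ρ := Real.sqrt_pos.2 hpos
    have hρ2 : ρ ^ 2 = x 1 ^ 2 + x 2 ^ 2 := Real.sq_sqrt hpos.le
    refine ⟨of ![x, ![0, -x 2 / ρ, x 1 / ρ], ![ρ, x 0 * x 1 / ρ, x 0 * x 2 / ρ]], ?_, rfl⟩
    refine .of_rows hx ?_ ?_ ?_ ?_ ?_ <;> simp <;> field_simp
    · linear_combination hρ2
    · linear_combination (ρ ^ 2 + x 1 ^ 2 + x 2 ^ 2 + 1) * hρ2 - (x 1 ^ 2 + x 2 ^ 2) * hx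
    · ring
    · linear_combination x 0 * hρ2
    · ring

theorem exists_isLorentzFrame_of_spacelike {x : Fin 3 → ℝ} (hx : lorentzNorm x = -1) :
    ∃ X, IsLorentzFrame X ∧ X 2 = x := by
  rw [lorentzNorm] at hx
  have hpos : 0 < 1 + x 0 ^ 2 := by positivity
  set ρ := √(1 + x 0 ^ 2)
  have hρ : 0 < ρ := Real.sqrt_pos.2 hpos
  have hρ2 : ρ ^ 2 = 1 + x 0 ^ 2 := Real.sq_sqrt hpos.le
  refine ⟨of ![![ρ, x 0 * x 1 / ρ, x 0 * x 2 / ρ], ![0, -x 2 / ρ, x 1 / ρ], x], ?_, rfl⟩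
  refine .of_rows ?_ ?_ hx ?_ ?_ ?_ <;> simp <;> field_simp
  · linear_combination (ρ ^ 2 + x 0 ^ 2) * hρ2 + x 0 ^ 2 * hx
  · linear_combination hρ2 + hx
  · ring
  · linear_combination x 0 * (hρ2 + hx)
  · ring

theorem exists_isLorentzFrame_of_lorentzNorm_ne_zero {x : Fin 3 → ℝ} (hx : lorentzNorm x ≠ 0) :
    ∃ X i, ∃ c : ℝ, IsLorentzFrame X ∧ (i = 0 ∨ i = 2) ∧ c ≠ 0 ∧ x = c • X i := by
  set c := √|lorentzNorm x|
  have hc : c ≠ 0 := (Real.sqrt_pos.2 (abs_pos.2 hx)).ne'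
  have hnorm : lorentzNorm (c⁻¹ • x) = lorentzNorm x / |lorentzNorm x| := by
    rw [lorentzNorm_smul, inv_pow, Real.sq_sqrt (abs_nonneg _), inv_mul_eq_div]
  rcases lt_or_gt_of_ne hx with hneg | hpos
  · rw [abs_of_neg hneg, div_neg, div_self hx] at hnorm
    obtain ⟨X, hX, hXx⟩ := exists_isLorentzFrame_of_spacelike hnorm
    exact ⟨X, 2, c, hX, .inr rfl, hc, by rw [hXx, smul_inv_smul₀ hc]⟩
  · rw [abs_of_pos hpos, div_self hx] at hnorm
    obtain ⟨X, hX, hXx⟩ := exists_isLorentzFrame_of_timelike hnorm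
    exact ⟨X, 0, c, hX, .inl rfl, hc, by rw [hXx, smul_inv_smul₀ hc]⟩

theorem IsNullNondegenerate.adjForm_mul_adjForm_pos {m : Matrix (Fin 3) (Fin 3) ℝ}
    (h : IsNullNondegenerate m) (θ φ : ℝ) :
    0 < adjForm m ![1, Real.cos θ, Real.sin θ] * adjForm m ![1, Real.cos φ, Real.sin φ] := by
  set F : ℝ → ℝ := fun θ => adjForm m ![1, Real.cos θ, Real.sin θ] with hF
  have hcont : Continuous F := by
    simp only [hF, adjForm, dotProduct, mulVec, Fin.sum_univ_three]
    simp only [cons_val]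
    fun_prop
  have hne : ∀ θ, F θ ≠ 0 := fun θ => by
    refine h _ (fun h0 => by simpa using congrFun h0 0) ?_
    simp [lorentzNorm, sub_sub]
  by_contra! hle
  obtain ⟨ψ, hψ⟩ : (0 : ℝ) ∈ Set.range F := by
    rcases mul_nonpos_iff.1 hle with ⟨h1, h2⟩ | ⟨h1, h2⟩
    · exact mem_range_of_exists_le_of_exists_ge hcont ⟨φ, h2⟩ ⟨θ, h1⟩
    · exact mem_range_of_exists_le_of_exists_ge hcont ⟨θ, h1⟩ ⟨φ, h2⟩
  exact hne ψ hψ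

theorem adjForm_diagonal (κ n : Fin 3 → ℝ) : adjForm (diagonal κ) n =
    κ 1 * κ 2 * n 0 ^ 2 + κ 0 * κ 2 * n 1 ^ 2 + κ 0 * κ 1 * n 2 ^ 2 := by
  rw [adjForm, adjugate_fin_three]
  simp only [dotProduct, mulVec, Fin.sum_univ_three, of_apply, cons_val', cons_val,
    cons_val_fin_one, diagonal_apply, Fin.reduceEq, zero_ne_one, one_ne_zero, if_true, if_false]
  ring

theorem isNullNondegenerate_diagonal_iff {κ : Fin 3 → ℝ} : IsNullNondegenerate (diagonal κ) ↔
    0 < κ 1 * κ 2 * (κ 1 + κ 0) * (κ 2 + κ 0) := by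
  constructor
  · intro h
    convert h.adjForm_mul_adjForm_pos 0 (Real.pi / 2) using 1
    simp only [adjForm_diagonal, cons_val, Real.cos_zero, Real.sin_zero, Real.cos_pi_div_two,
      Real.sin_pi_div_two]
    ring
  · intro h n hn hnull h0
    simp only [lorentzNorm, adjForm_diagonal] at hnull h0
    have hP : κ 2 * (κ 1 + κ 0) ≠ 0 := fun hP =>
      h.ne' (by linear_combination κ 1 * (κ 2 + κ 0) * hP)
    have hsum : (κ 2 * (κ 1 + κ 0) * n 1) ^ 2 +
        κ 1 * κ 2 * (κ 1 + κ 0) * (κ 2 + κ 0) * n 2 ^ 2 = 0 := by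
      linear_combination κ 2 * (κ 1 + κ 0) * (h0 - κ 1 * κ 2 * hnull)
    obtain ⟨h1, h2⟩ := (add_eq_zero_iff_of_nonneg (sq_nonneg _) (by positivity)).1 hsum
    replace h1 : n 1 = 0 := by simpa [hP] using h1
    replace h2 : n 2 = 0 := by simpa [h.ne'] using h2
    have h3 : n 0 = 0 := by simpa [h1, h2] using hnull
    exact hn (funext fun i => by fin_cases i <;> assumption)

namespace IsLorentzDiagonalizable

theorem congr {X m : Matrix (Fin 3) (Fin 3) ℝ} (hX : IsLorentzFrame X)
    (hm : IsLorentzDiagonalizable m) : IsLorentzDiagonalizable (Xᵀ * m * X) := by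
  obtain ⟨Y, κ, hY, rfl⟩ := hm
  exact ⟨Y * X, κ, hX.mul hY, by simp only [transpose_mul, Matrix.mul_assoc]⟩

theorem of_isDiag {X m : Matrix (Fin 3) (Fin 3) ℝ} (hX : IsLorentzFrame X)
    (hm : (X * m * Xᵀ).IsDiag) : IsLorentzDiagonalizable m := by
  have hκ : diagonal (diag (X * m * Xᵀ)) = X * m * Xᵀ := hm.diagonal_diag
  have hη : lorentzᵀ = lorentz := diagonal_transpose _
  have hinv : lorentz * Xᵀ * lorentz * X = 1 := by
    rw [Matrix.mul_assoc, Matrix.mul_assoc, ← Matrix.mul_assoc Xᵀ, hX.transpose_mul_lorentz_mul,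
      lorentz_mul_self]
  refine ⟨lorentz * X * lorentz, diag (X * m * Xᵀ), ?_, ?_⟩
  · rw [IsLorentzFrame, transpose_mul, transpose_mul, hη]
    calc _ = lorentz * (X * (lorentz * lorentz) * lorentz * Xᵀ) * lorentz := by
          simp only [Matrix.mul_assoc]
      _ = lorentz := by
          rw [lorentz_mul_self, Matrix.mul_one, hX, lorentz_mul_self, Matrix.one_mul]
  · have hinv' := congrArg transpose hinv
    simp only [transpose_mul, transpose_transpose, hη, transpose_one] at hinv'
    rw [hκ, transpose_mul, transpose_mul, hη]
    calc m = (lorentz * Xᵀ * lorentz * X) * m * (Xᵀ * (lorentz * (X * lorentz))) := by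
          rw [hinv, hinv', Matrix.one_mul, Matrix.mul_one]
      _ = _ := by simp only [Matrix.mul_assoc]

theorem of_timelike_block (l a b c : ℝ) :
    IsLorentzDiagonalizable !![l, 0, 0; 0, a, b; 0, b, c] := by
  obtain ⟨θ, hθ⟩ := exists_mul_sin_eq_mul_cos (a - c) (2 * b)
  rw [Real.sin_two_mul, Real.cos_two_mul'] at hθ
  have h1 := Real.cos_sq_add_sin_sq θ
  refine of_isDiag (X := !![1, 0, 0; 0, θ.cos, θ.sin; 0, -θ.sin, θ.cos]) ?_ fun i j hij => ?_
  · apply IsLorentzFrame.of_rows <;> simp <;> linarith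
  · fin_cases i <;> fin_cases j <;> simp [mul_apply, Fin.sum_univ_three] at hij ⊢ <;> linarith

theorem of_spacelike_block {p q r : ℝ} (l : ℝ) (h : |2 * q| < |p + r|) :
    IsLorentzDiagonalizable !![p, q, 0; q, r, 0; 0, 0, l] := by
  obtain ⟨t, ht⟩ := exists_mul_sinh_eq_mul_cosh (a := p + r) (b := -(2 * q)) (by rwa [abs_neg])
  rw [Real.sinh_two_mul, Real.cosh_two_mul] at ht
  have h1 := Real.cosh_sq_sub_sinh_sq t
  refine of_isDiag (X := !![t.cosh, t.sinh, 0; t.sinh, t.cosh, 0; 0, 0, 1]) ?_ fun i j hij => ?_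
  · apply IsLorentzFrame.of_rows <;> simp <;> linarith
  · fin_cases i <;> fin_cases j <;> simp [mul_apply, Fin.sum_univ_three] at hij ⊢ <;> linarith

end IsLorentzDiagonalizable

theorem IsLorentzFrame.apply_eq_zero_of_eigenvector {X m : Matrix (Fin 3) (Fin 3) ℝ}
    (hX : IsLorentzFrame X) {i j : Fin 3} {l c : ℝ} (hc : c ≠ 0)
    (h : (Xᵀ * m * X) *ᵥ lorentz *ᵥ (c • X i) = l • c • X i) (hij : j ≠ i) : m j i = 0 := by
  have hXi : X i = Xᵀ *ᵥ Pi.single i 1 := (mulVec_single_one Xᵀ i).symm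
  have hm : m *ᵥ lorentz *ᵥ Pi.single i 1 = l • Pi.single i 1 := by
    refine mulVec_injective_of_isUnit hX.isUnit_transpose (smul_right_injective _ hc ?_)
    simp only [mulVec_smul, ← hXi, smul_comm c l, ← h]
    simp only [hXi, mulVec_mulVec, Matrix.mul_assoc]
    rw [← Matrix.mul_assoc X, hX]
  have hη : (![1, -1, -1] : Fin 3 → ℝ) i ≠ 0 := by fin_cases i <;> simp
  simpa [mulVec_mulVec, lorentz, mul_diagonal, hij, hη] using congrFun hm j

theorem IsNullNondegenerate.exists_nonnull_eigenvector {m : Matrix (Fin 3) (Fin 3) ℝ}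
    (h : IsNullNondegenerate m) :
    ∃ (l : ℝ) (x : Fin 3 → ℝ), lorentzNorm x ≠ 0 ∧ m *ᵥ lorentz *ᵥ x = l • x := by
  obtain ⟨l, x, hx, hlx⟩ := exists_mulVec_eq_smul_of_odd_card (by decide) (m * lorentz)
  rw [← mulVec_mulVec] at hlx
  refine ⟨l, x, fun h0 => h x hx h0 ?_, hlx⟩
  refine (adjForm_eq_zero_iff hx).2 ⟨lorentz *ᵥ x, fun h1 => hx ?_, ?_, l, hlx⟩
  · rw [← lorentz_mulVec_lorentz_mulVec x, h1, mulVec_zero]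
  · rw [dotProduct_comm, dotProduct_lorentz_mulVec, h0]

theorem IsNullNondegenerate.isLorentzDiagonalizable_of_spacelike_block {p q r l : ℝ}
    (h : IsNullNondegenerate !![p, q, 0; q, r, 0; 0, 0, l]) :
    IsLorentzDiagonalizable !![p, q, 0; q, r, 0; 0, 0, l] := by
  refine .of_spacelike_block l (sq_lt_sq.1 ?_)
  have hfactor : 0 < l ^ 2 * ((p + r) ^ 2 - (2 * q) ^ 2) := by
    convert h.adjForm_mul_adjForm_pos 0 Real.pi using 1
    simp only [adjForm, adjugate_fin_three, mulVec, dotProduct, Fin.sum_univ_three, of_apply,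
      cons_val', cons_val, cons_val_fin_one, Real.cos_zero, Real.sin_zero, Real.cos_pi,
      Real.sin_pi]
    ring
  linarith [pos_of_mul_pos_right hfactor (sq_nonneg l)]

theorem IsNullNondegenerate.isLorentzDiagonalizable {m : Matrix (Fin 3) (Fin 3) ℝ}
    (h : IsNullNondegenerate m) (hm : m.IsSymm) : IsLorentzDiagonalizable m := by
  obtain ⟨l, x, hx, hlx⟩ := h.exists_nonnull_eigenvector
  obtain ⟨X, i, c, hX, hi, hc, rfl⟩ := exists_isLorentzFrame_of_lorentzNorm_ne_zero hx
  obtain ⟨m, hm', rfl⟩ := hX.exists_congr_eq hm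
  replace h := hX.isNullNondegenerate h
  have hcol : ∀ j ≠ i, m j i = 0 := fun j hj => hX.apply_eq_zero_of_eigenvector hc hlx hj
  have hrow : ∀ j ≠ i, m i j = 0 := fun j hj => (hm'.apply j i).trans (hcol j hj)
  refine .congr hX ?_
  rcases hi with rfl | rfl
  · have hblock : m = !![m 0 0, 0, 0; 0, m 1 1, m 1 2; 0, m 1 2, m 2 2] := by
      ext i j
      fin_cases i <;> fin_cases j <;> simp [hcol, hrow, hm'.apply 1 2]
    exact hblock ▸ .of_timelike_block ..
  · have hblock : m = !![m 0 0, m 0 1, 0; m 0 1, m 1 1, 0; 0, 0, m 2 2] := by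
      ext i j
      fin_cases i <;> fin_cases j <;> simp [hcol, hrow, hm'.apply 0 1]
    rw [hblock] at h ⊢
    exact h.isLorentzDiagonalizable_of_spacelike_block

theorem eq_smul_lorentz_of_forall_null {B : Matrix (Fin 3) (Fin 3) ℝ} (hB : B.IsSymm)
    (h : ∀ n ≠ 0, lorentzNorm n = 0 → n ⬝ᵥ B *ᵥ n = 0) : B = B 0 0 • lorentz := by
  have hn : ∀ {a b c : ℝ}, a ≠ 0 → a ^ 2 - b ^ 2 - c ^ 2 = 0 →
      B 0 0 * a ^ 2 + B 1 1 * b ^ 2 + B 2 2 * c ^ 2 +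
        2 * (B 0 1 * a * b + B 0 2 * a * c + B 1 2 * b * c) = 0 := fun {a b c} ha hnull => by
    have := h ![a, b, c] (fun h0 => ha (congrFun h0 0)) hnull
    simp only [dotProduct, mulVec, Fin.sum_univ_three, cons_val, hB.apply 0 1, hB.apply 0 2,
      hB.apply 1 2] at this
    linear_combination this
  have h1 := hn (a := 1) (b := 1) (c := 0) (by simp) (by simp)
  have h2 := hn (a := 1) (b := -1) (c := 0) (by simp) (by simp)
  have h3 := hn (a := 1) (b := 0) (c := 1) (by simp) (by simp)
  have h4 := hn (a := 1) (b := 0) (c := -1) (by simp) (by simp)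
  have h5 := hn (a := 5) (b := 3) (c := 4) (by simp) (by norm_num)
  ext i j
  fin_cases i <;> fin_cases j <;>
    simp [lorentz, hB.apply 0 1, hB.apply 0 2, hB.apply 1 2] <;> linarith

theorem exists_eq_smul_vecMulVec_of_adjugate_eq_zero {m : Matrix (Fin 3) (Fin 3) ℝ}
    (hm : m.IsSymm) (h : m.adjugate = 0) : ∃ (σ : ℝ) (l : Fin 3 → ℝ), m = σ • vecMulVec l l := by
  have hminor : ∀ i j k, m i i * m j k = m i j * m i k := by
    rw [adjugate_fin_three] at h
    have hadj := fun i j => congrFun₂ h i j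
    simp only [Fin.forall_fin_succ, of_apply, Matrix.zero_apply, Fin.succ_zero_eq_one,
      cons_val, Fin.succ_one_eq_two, hm.apply 0 1, hm.apply 0 2, hm.apply 1 2] at hadj
    intro i j k
    fin_cases i <;> fin_cases j <;> fin_cases k <;>
      simp only [Fin.zero_eta, Fin.mk_one, Fin.reduceFinMk, hm.apply 0 1, hm.apply 0 2,
        hm.apply 1 2] <;> grind
  by_cases hdiag : ∃ i, m i i ≠ 0
  · obtain ⟨i, hi⟩ := hdiag
    refine ⟨(m i i)⁻¹, m i, ext fun j k => ?_⟩
    rw [Matrix.smul_apply, vecMulVec_apply, ← hminor, smul_eq_mul, inv_mul_cancel_left₀ hi]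
  · push Not at hdiag
    refine ⟨0, 0, ext fun i j => ?_⟩
    have := hminor i j j
    rw [hdiag, hdiag, mul_zero, zero_eq_mul_self] at this
    rw [this]
    simp

theorem eq_smul_lorentz_or_eq_smul_vecMulVec {m : Matrix (Fin 3) (Fin 3) ℝ} (hm : m.IsSymm)
    (h : ∀ n ≠ 0, lorentzNorm n = 0 → adjForm m n = 0) :
    (∃ c : ℝ, m = c • lorentz) ∨ ∃ (σ : ℝ) (l : Fin 3 → ℝ), m = σ • vecMulVec l l := by
  have hadj := eq_smul_lorentz_of_forall_null (by rw [IsSymm, adjugate_transpose, hm]) h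
  set k := m.adjugate 0 0
  rcases eq_or_ne k 0 with hk | hk
  · rw [hk, zero_smul] at hadj
    exact .inr (exists_eq_smul_vecMulVec_of_adjugate_eq_zero hm hadj)
  · refine .inl ⟨k⁻¹ * m.det, ?_⟩
    have hprod : k • (m * lorentz) = m.det • 1 := by
      rw [← mul_smul_comm, ← hadj, mul_adjugate]
    calc m = k⁻¹ • (k • (m * lorentz)) * lorentz := by
          rw [inv_smul_smul₀ hk, Matrix.mul_assoc, lorentz_mul_self, Matrix.mul_one]
      _ = (k⁻¹ * m.det) • lorentz := by rw [hprod, smul_smul, smul_mul, Matrix.one_mul]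

theorem IsLorentzDiagonalizable.smul_lorentz (c : ℝ) : IsLorentzDiagonalizable (c • lorentz) :=
  ⟨1, c • ![1, -1, -1], .one, by simp [lorentz, ← diagonal_smul]⟩

theorem IsLorentzDiagonalizable.zero : IsLorentzDiagonalizable 0 :=
  zero_smul ℝ lorentz ▸ .smul_lorentz 0

theorem IsLorentzDiagonalizable.smul_vecMulVec (σ : ℝ) {l : Fin 3 → ℝ} (hl : lorentzNorm l ≠ 0) :
    IsLorentzDiagonalizable (σ • vecMulVec l l) := by
  obtain ⟨X, i, c, hX, -, -, rfl⟩ := exists_isLorentzFrame_of_lorentzNorm_ne_zero hl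
  refine ⟨X, Pi.single i (σ * c ^ 2), hX, ?_⟩
  ext j k
  simp only [mul_apply, transpose_apply, diagonal_apply, Pi.single_apply, Matrix.smul_apply,
    vecMulVec_apply, Pi.smul_apply, smul_eq_mul, mul_ite, mul_zero, ite_mul, zero_mul,
    Finset.sum_ite_eq', Finset.mem_univ, if_true]
  ring

/-! ### Jacobi operators -/

section Basic

variable {g : LinearMap.BilinForm ℝ V} {Ψ : V →ₗ[ℝ] V}

@[simp]
theorem constCurv_apply (g : LinearMap.BilinForm ℝ V) (x y z v : V) :
    constCurv g x y z v = g y z * g x v - g x z * g y v := rfl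

@[simp]
theorem endoCurv_apply (g : LinearMap.BilinForm ℝ V) (Ψ : V →ₗ[ℝ] V) (x y z v : V) :
    endoCurv g Ψ x y z v =
      g (Ψ y) z * g (Ψ x) v - g (Ψ x) z * g (Ψ y) v - 2 * g (Ψ x) y * g (Ψ z) v := rfl

theorem isSkewAdjoint_iff : g.IsSkewAdjoint Ψ ↔ ∀ x y, g (Ψ x) y = -g x (Ψ y) :=
  forall₂_congr fun x y => by simp only [Pi.neg_apply, map_neg]

theorem form_skewAdjoint_self (hg : g.IsSymm) (h : g.IsSkewAdjoint Ψ) (x : V) :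
    g (Ψ x) x = 0 := by
  linarith [isSkewAdjoint_iff.1 h x x, hg.eq x (Ψ x)]

namespace Model

variable (M : Model V)

theorem form_ext {x y : V} (h : ∀ z, M.form x z = M.form y z) : x = y :=
  sub_eq_zero.1 <| M.form_nondegenerate.1 _ fun z => by
    rw [map_sub, LinearMap.sub_apply, h z, sub_self]

variable [FiniteDimensional ℝ V]

theorem jacobi_eq_iff {x : V} {T : V →ₗ[ℝ] V} :
    M.jacobi x = T ↔ ∀ y z, M.form (T y) z = M.curv y x x z :=
  ⟨fun h y z => h ▸ M.form_jacobi x y z, fun h => LinearMap.ext fun y =>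
    M.form_ext fun z => (M.form_jacobi x y z).trans (h y z).symm⟩

theorem jacobi_smul (t : ℝ) (x : V) : M.jacobi (t • x) = t ^ 2 • M.jacobi x := by
  rw [jacobi_eq_iff]
  intro y z
  simp only [map_smul, LinearMap.smul_apply, form_jacobi, smul_eq_mul]
  ring

end Model

end Basic

section QuadOp

variable {ι : Type*} {g : LinearMap.BilinForm ℝ V} {a : ι → V}

/-- The inner products of a vector with the vectors of a finite family `a`. -/
def pairing (g : LinearMap.BilinForm ℝ V) (a : ι → V) : V →ₗ[ℝ] ι → ℝ :=
  LinearMap.pi fun i => g (a i)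

@[simp]
theorem pairing_apply (g : LinearMap.BilinForm ℝ V) (a : ι → V) (y : V) (i : ι) :
    pairing g a y i = g (a i) y := rfl

variable [Fintype ι]

/-- The operator `y ↦ ∑ mᵢⱼ ⟨aⱼ, y⟩ aᵢ`. On a null vector `v`, all Jacobi operators considered here
have this form, for a family `a` depending on `v` and a coefficient matrix independent of `v`. -/
def quadOp (g : LinearMap.BilinForm ℝ V) (m : Matrix ι ι ℝ) (a : ι → V) : V →ₗ[ℝ] V :=
  Fintype.linearCombination ℝ a ∘ₗ m.mulVecLin ∘ₗ pairing g a

theorem quadOp_apply (g : LinearMap.BilinForm ℝ V) (m : Matrix ι ι ℝ) (a : ι → V) (y : V) :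
    quadOp g m a y = ∑ i, (m *ᵥ pairing g a y) i • a i := rfl

theorem form_linearCombination (g : LinearMap.BilinForm ℝ V) (a : ι → V) (c : ι → ℝ) (y : V) :
    g (Fintype.linearCombination ℝ a c) y = c ⬝ᵥ pairing g a y := by
  simp only [Fintype.linearCombination_apply, map_sum, map_smul, LinearMap.sum_apply,
    LinearMap.smul_apply, smul_eq_mul, dotProduct, pairing_apply]

theorem quadOp_smul_vecMulVec (g : LinearMap.BilinForm ℝ V) (σ : ℝ)
    (l : ι → ℝ) (a : ι → V) (y : V) :
    quadOp g (σ • vecMulVec l l) a y =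
      (σ * g (Fintype.linearCombination ℝ a l) y) • Fintype.linearCombination ℝ a l := by
  rw [quadOp, LinearMap.comp_apply, LinearMap.comp_apply, mulVecLin_apply, smul_mulVec,
    vecMulVec_mulVec, form_linearCombination, map_smul, op_smul_eq_smul, map_smul, smul_smul]

theorem form_quadOp (g : LinearMap.BilinForm ℝ V) (m : Matrix ι ι ℝ) (a : ι → V) (y z : V) :
    g (quadOp g m a y) z = m *ᵥ pairing g a y ⬝ᵥ pairing g a z :=
  form_linearCombination g a _ z

theorem pairing_linearCombination_of_isotropic (ha : ∀ i j, g (a i) (a j) = 0) (c : ι → ℝ) :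
    pairing g a (Fintype.linearCombination ℝ a c) = 0 := by
  ext i
  simp only [pairing_apply, Fintype.linearCombination_apply, map_sum, map_smul, ha, smul_zero,
    Finset.sum_const_zero, Pi.zero_apply]

theorem quadOp_comp_self_of_isotropic (ha : ∀ i j, g (a i) (a j) = 0) (m : Matrix ι ι ℝ) :
    quadOp g m a ∘ₗ quadOp g m a = 0 := by
  ext y
  simp only [quadOp, LinearMap.comp_apply, pairing_linearCombination_of_isotropic ha, map_zero,
    LinearMap.zero_apply]

theorem ker_pairing (g : LinearMap.BilinForm ℝ V) (a : ι → V) :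
    LinearMap.ker (pairing g a) =
      g.orthogonal (LinearMap.range (Fintype.linearCombination ℝ a)) := by
  ext y
  rw [LinearMap.mem_ker, LinearMap.BilinForm.mem_orthogonal_iff]
  constructor
  · rintro h _ ⟨c, rfl⟩
    rw [form_linearCombination, h, dotProduct_zero]
  · intro h
    classical
    ext i
    simpa using h _ ⟨Pi.single i 1, rfl⟩

variable [FiniteDimensional ℝ V]

theorem finrank_range_pairing (hg : g.Nondegenerate) (a : ι → V) :
    finrank ℝ (LinearMap.range (pairing g a)) =
      finrank ℝ (LinearMap.range (Fintype.linearCombination ℝ a)) := by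
  have hker := LinearMap.BilinForm.finrank_orthogonal hg
    (LinearMap.range (Fintype.linearCombination ℝ a))
  rw [← ker_pairing] at hker
  have := (pairing g a).finrank_range_add_finrank_ker
  have := (LinearMap.range (Fintype.linearCombination ℝ a)).finrank_le
  omega

theorem finrank_range_quadOp_of_linearIndependent (hg : g.Nondegenerate)
    (ha : LinearIndependent ℝ a) (m : Matrix ι ι ℝ) :
    finrank ℝ (LinearMap.range (quadOp g m a)) = m.rank := by
  have hinj := linearIndependent_iff_injective_fintypeLinearCombination.1 ha
  have hsurj : LinearMap.range (pairing g a) = ⊤ := by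
    refine Submodule.eq_top_of_finrank_eq ?_
    rw [finrank_range_pairing hg, LinearMap.finrank_range_of_inj hinj]
  rw [quadOp, LinearMap.range_comp, LinearMap.range_comp_of_range_eq_top _ hsurj,
    ← (Submodule.equivMapOfInjective _ hinj _).finrank_eq]
  rfl

theorem Model.isNullJordanOsserman_of_jacobi_eq_quadOp {M : Model V} (m : Matrix ι ι ℝ)
    (a : V → ι → V) (hind : ∀ v ∈ M.nullCone, LinearIndependent ℝ (a v))
    (hiso : ∀ v ∈ M.nullCone, ∀ i j, M.form (a v i) (a v j) = 0)
    (hJ : ∀ v ∈ M.nullCone, M.jacobi v = quadOp M.form m (a v)) : M.IsNullJordanOsserman := by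
  intro v hv w hw
  have hrank : ∀ u ∈ M.nullCone, finrank ℝ (LinearMap.range (M.jacobi u)) = m.rank :=
    fun u hu => hJ u hu ▸
      finrank_range_quadOp_of_linearIndependent M.form_nondegenerate (hind u hu) m
  have hsq : ∀ u ∈ M.nullCone, M.jacobi u ∘ₗ M.jacobi u = 0 :=
    fun u hu => hJ u hu ▸ quadOp_comp_self_of_isotropic (hiso u hu) m
  refine exists_conj_of_comp_self_eq_zero (hsq v hv) (hsq w hw) ?_
  have := (M.jacobi v).finrank_range_add_finrank_ker
  have := (M.jacobi w).finrank_range_add_finrank_ker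
  have := hrank v hv
  have := hrank w hw
  omega

end QuadOp

/-! ### Curvature tensors of skew-adjoint endomorphisms -/

namespace IsAlgebraicCurvatureTensor

variable {A B : Tensor4 V}

theorem skew_right (hA : IsAlgebraicCurvatureTensor A) (x y z v : V) :
    A x y z v = -A x y v z := by
  rw [hA.pair, hA.skew, hA.pair]

theorem reverse (hA : IsAlgebraicCurvatureTensor A) (x y z v : V) : A x y z v = A v z y x := by
  rw [hA.pair, hA.skew, hA.skew_right, neg_neg]

theorem self_left (hA : IsAlgebraicCurvatureTensor A) (x z v : V) : A x x z v = 0 :=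
  self_eq_neg.1 (hA.skew x x z v)

theorem self_right (hA : IsAlgebraicCurvatureTensor A) (x y z : V) : A x y z z = 0 :=
  self_eq_neg.1 (hA.skew_right x y z z)

protected theorem smul (hA : IsAlgebraicCurvatureTensor A) (t : ℝ) :
    IsAlgebraicCurvatureTensor (t • A) where
  skew x y z v := by simp only [LinearMap.smul_apply, hA.skew x y z v, smul_neg]
  pair x y z v := by simp only [LinearMap.smul_apply, hA.pair x y z v]
  bianchi x y z v := by
    simp only [LinearMap.smul_apply, ← smul_add, hA.bianchi x y z v, smul_zero]

theorem apply_smul_add_smul (hA : IsAlgebraicCurvatureTensor A) (x y : V) (p q r t : ℝ) :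
    A (p • x + q • y) (r • x + t • y) (p • x + q • y) (r • x + t • y) =
      (p * t - q * r) ^ 2 * A x y x y := by
  simp only [map_add, map_smul, LinearMap.add_apply, LinearMap.smul_apply, smul_eq_mul,
    hA.self_left, hA.self_right, hA.skew y x x y, hA.skew y x y x, hA.skew_right x y y x]
  ring

theorem ext_of_basis {ι : Type*} [LinearOrder ι] (hA : IsAlgebraicCurvatureTensor A)
    (hB : IsAlgebraicCurvatureTensor B) (b : Basis ι ℝ V)
    (h : ∀ i j k l, i < j → k < l → toLex (i, j) ≤ toLex (k, l) →
      A (b i) (b j) (b k) (b l) = B (b i) (b j) (b k) (b l)) : A = B := by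
  have hlt_lt : ∀ i j k l, i < j → k < l →
      A (b i) (b j) (b k) (b l) = B (b i) (b j) (b k) (b l) := by
    intro i j k l hij hkl
    rcases le_total (toLex (i, j)) (toLex (k, l)) with hle | hle
    · exact h i j k l hij hkl hle
    · rw [hA.pair, hB.pair, h k l i j hkl hij hle]
  have hlt : ∀ i j k l, i < j → A (b i) (b j) (b k) (b l) = B (b i) (b j) (b k) (b l) := by
    intro i j k l hij
    rcases lt_trichotomy k l with hkl | rfl | hlk
    · exact hlt_lt i j k l hij hkl
    · rw [hA.self_right, hB.self_right]
    · rw [hA.skew_right, hlt_lt i j l k hij hlk, ← hB.skew_right]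
  refine b.ext fun i => b.ext fun j => b.ext fun k => b.ext fun l => ?_
  rcases lt_trichotomy i j with hij | rfl | hji
  · exact hlt i j k l hij
  · rw [hA.self_left, hB.self_left]
  · rw [hA.skew, hlt j i k l hji, ← hB.skew]

end IsAlgebraicCurvatureTensor

theorem isAlgebraicCurvatureTensor_constCurv {g : LinearMap.BilinForm ℝ V} (hg : g.IsSymm) :
    IsAlgebraicCurvatureTensor (constCurv g) where
  skew x y z v := by simp only [constCurv_apply]; ring
  pair x y z v := by
    simp only [constCurv_apply, hg.eq v x, hg.eq z y, hg.eq z x, hg.eq v y]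
    ring
  bianchi x y z v := by
    simp only [constCurv_apply, hg.eq z x, hg.eq y x, hg.eq z y]
    ring

section QuadCurv

variable {ι : Type*} [Fintype ι] {g : LinearMap.BilinForm ℝ V} {m : Matrix ι ι ℝ}
  {Ψ : ι → V →ₗ[ℝ] V}

/-- The bilinear map in `(Ψ, Φ)` whose restriction to the diagonal is `Ψ ↦ A^Ψ`. It is not
symmetrized, so its values satisfy the symmetries of a curvature tensor only after
symmetrization. -/
def polarCurv (g : LinearMap.BilinForm ℝ V) :
    (V →ₗ[ℝ] V) →ₗ[ℝ] (V →ₗ[ℝ] V) →ₗ[ℝ] Tensor4 V :=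
  LinearMap.mk₂ ℝ
    (fun Ψ Φ => LinearMap.mk₂ ℝ
      (fun x y => LinearMap.mk₂ ℝ
        (fun z v => g (Ψ y) z * g (Φ x) v - g (Ψ x) z * g (Φ y) v - 2 * g (Ψ x) y * g (Φ z) v)
        (by intros; simp; ring) (by intros; simp; ring)
        (by intros; simp; ring) (by intros; simp; ring))
      (by intros; ext; simp; ring) (by intros; ext; simp; ring)
      (by intros; ext; simp; ring) (by intros; ext; simp; ring))
    (by intros; ext; simp; ring) (by intros; ext; simp; ring)
    (by intros; ext; simp; ring) (by intros; ext; simp; ring)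

theorem polarCurv_apply (g : LinearMap.BilinForm ℝ V) (Ψ Φ : V →ₗ[ℝ] V) (x y z v : V) :
    polarCurv g Ψ Φ x y z v =
      g (Ψ y) z * g (Φ x) v - g (Ψ x) z * g (Φ y) v - 2 * g (Ψ x) y * g (Φ z) v := rfl

theorem polarCurv_self (g : LinearMap.BilinForm ℝ V) (Ψ : V →ₗ[ℝ] V) :
    polarCurv g Ψ Ψ = endoCurv g Ψ := rfl

/-- The tensor `∑ mᵢⱼ A^{Ψᵢ, Ψⱼ}`, where `A^{Ψ, Φ}` is the polarization of `A^Ψ`. -/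
def quadCurv (g : LinearMap.BilinForm ℝ V) (m : Matrix ι ι ℝ) (Ψ : ι → V →ₗ[ℝ] V) : Tensor4 V :=
  ∑ i, ∑ j, m i j • polarCurv g (Ψ i) (Ψ j)

theorem quadCurv_apply (g : LinearMap.BilinForm ℝ V) (m : Matrix ι ι ℝ) (Ψ : ι → V →ₗ[ℝ] V)
    (x y z v : V) :
    quadCurv g m Ψ x y z v = ∑ i, ∑ j, m i j * (g (Ψ i y) z * g (Ψ j x) v -
      g (Ψ i x) z * g (Ψ j y) v - 2 * g (Ψ i x) y * g (Ψ j z) v) := by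
  simp only [quadCurv, LinearMap.sum_apply, LinearMap.smul_apply, polarCurv_apply, smul_eq_mul]

theorem quadCurv_congr {κ : Type*} [Fintype κ] (g : LinearMap.BilinForm ℝ V) (X : Matrix κ ι ℝ)
    (m : Matrix κ κ ℝ) (Ψ : ι → V →ₗ[ℝ] V) :
    quadCurv g (Xᵀ * m * X) Ψ = quadCurv g m fun k => Fintype.linearCombination ℝ Ψ (X k) := by
  have hentry : ∀ i j, (Xᵀ * m * X) i j = ∑ k, ∑ l, m k l * X k i * X l j := fun i j => by
    rw [Matrix.mul_assoc, mul_apply]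
    simp only [mul_apply, transpose_apply, Finset.mul_sum]
    exact Finset.sum_congr rfl fun k _ => Finset.sum_congr rfl fun l _ => by ring
  have hpolar : ∀ k l, m k l • polarCurv g (Fintype.linearCombination ℝ Ψ (X k))
      (Fintype.linearCombination ℝ Ψ (X l)) =
      ∑ i, ∑ j, (m k l * X k i * X l j) • polarCurv g (Ψ i) (Ψ j) := fun k l => by
    simp only [Fintype.linearCombination_apply, map_sum, map_smul, LinearMap.sum_apply,
      LinearMap.smul_apply, Finset.smul_sum, smul_smul, mul_assoc, mul_comm (X l _) (X k _)]
    exact Finset.sum_comm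
  simp only [quadCurv, hentry, hpolar, Finset.sum_smul]
  calc _ = ∑ i, ∑ k, ∑ j, ∑ l, (m k l * X k i * X l j) • polarCurv g (Ψ i) (Ψ j) :=
        Finset.sum_congr rfl fun i _ => Finset.sum_comm
    _ = ∑ k, ∑ i, ∑ l, ∑ j, (m k l * X k i * X l j) • polarCurv g (Ψ i) (Ψ j) :=
        Finset.sum_comm.trans <| Finset.sum_congr rfl fun k _ =>
          Finset.sum_congr rfl fun i _ => Finset.sum_comm
    _ = _ := Finset.sum_congr rfl fun k _ => Finset.sum_comm

theorem quadCurv_diagonal [DecidableEq ι] (g : LinearMap.BilinForm ℝ V) (κ : ι → ℝ)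
    (Ψ : ι → V →ₗ[ℝ] V) : quadCurv g (diagonal κ) Ψ = ∑ k, κ k • endoCurv g (Ψ k) := by
  simp only [quadCurv, diagonal_apply, ite_smul, zero_smul, Finset.sum_ite_eq, Finset.mem_univ,
    if_true, polarCurv_self]

theorem isAlgebraicCurvatureTensor_quadCurv (hg : g.IsSymm) (hm : m.IsSymm)
    (hΨ : ∀ i, g.IsSkewAdjoint (Ψ i)) : IsAlgebraicCurvatureTensor (quadCurv g m Ψ) := by
  have hs : ∀ i x y, g (Ψ i x) y = -g (Ψ i y) x := fun i x y => by
    rw [isSkewAdjoint_iff.1 (hΨ i), hg.eq]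
  constructor
  · intro x y z v
    simp only [quadCurv_apply, ← Finset.sum_neg_distrib]
    refine Finset.sum_congr rfl fun i _ => Finset.sum_congr rfl fun j _ => ?_
    rw [hs i y x]
    ring
  · intro x y z v
    simp only [quadCurv_apply, mul_sub, Finset.sum_sub_distrib]
    congr 1
    · congr 1
      · rw [Finset.sum_comm]
        refine Finset.sum_congr rfl fun j _ => Finset.sum_congr rfl fun i _ => ?_
        rw [hm.apply, hs j v x, hs i z y]
        ring
      · refine Finset.sum_congr rfl fun i _ => Finset.sum_congr rfl fun j _ => ?_
        rw [hs i z x, hs j v y]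
        ring
    · rw [Finset.sum_comm]
      refine Finset.sum_congr rfl fun j _ => Finset.sum_congr rfl fun i _ => ?_
      rw [hm.apply]
      ring
  · intro x y z v
    simp only [quadCurv_apply, ← Finset.sum_add_distrib]
    refine Finset.sum_eq_zero fun i _ => Finset.sum_eq_zero fun j _ => ?_
    rw [hs i z x, hs i z y, hs i y x]
    ring

theorem Model.jacobi_quadCurv [FiniteDimensional ℝ V] {M : Model V} (hm : m.IsSymm)
    (hΨ : ∀ i, M.form.IsSkewAdjoint (Ψ i)) (hA : M.curv = quadCurv M.form m Ψ) (v : V) :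
    M.jacobi v = (3 : ℝ) • quadOp M.form m fun i => Ψ i v := by
  rw [jacobi_eq_iff]
  intro y z
  rw [LinearMap.smul_apply, map_smul, LinearMap.smul_apply, form_quadOp, hA, quadCurv_apply,
    Finset.sum_comm]
  simp only [dotProduct, Matrix.mulVec, Finset.sum_mul, pairing_apply, smul_eq_mul, Finset.mul_sum]
  refine Finset.sum_congr rfl fun j _ => Finset.sum_congr rfl fun i _ => ?_
  rw [form_skewAdjoint_self M.form_symm (hΨ i), hm.apply,
    isSkewAdjoint_iff.1 (hΨ i) y v, M.form_symm.eq]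
  ring

end QuadCurv

/-! ### Clifford triples -/

section Clifford

/-- A paraquaternionic structure, presented by its Clifford relations: the operators
`∑ cᵢ Ψᵢ` square to minus the Lorentz norm of `c`. -/
structure IsCliffordTriple (g : LinearMap.BilinForm ℝ V) (Ψ : Fin 3 → V →ₗ[ℝ] V) : Prop where
  skew : ∀ i, g.IsSkewAdjoint (Ψ i)
  anticomm : ∀ i j, Ψ i ∘ₗ Ψ j + Ψ j ∘ₗ Ψ i = (-2 * lorentz i j) • LinearMap.id

variable {g : LinearMap.BilinForm ℝ V} {Ψ : Fin 3 → V →ₗ[ℝ] V} {v : V}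

theorem IsParaquaternionic.isCliffordTriple {Ψ₁ Ψ₂ Ψ₃ : V →ₗ[ℝ] V}
    (h : IsParaquaternionic g Ψ₁ Ψ₂ Ψ₃) : IsCliffordTriple g ![Ψ₁, Ψ₂, Ψ₃] where
  skew := by simp [Fin.forall_fin_succ, h.complex₁.1, h.para₂.1, h.para₃.1]
  anticomm i j := by
    fin_cases i <;> fin_cases j <;>
      simp [lorentz, h.complex₁.2, h.para₂.2, h.para₃.2, h.anti₁₂, h.anti₁₃, h.anti₂₃,
        add_comm (Ψ₂ ∘ₗ Ψ₁), add_comm (Ψ₃ ∘ₗ Ψ₁), add_comm (Ψ₃ ∘ₗ Ψ₂)] <;> module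

theorem linearCombination_apply (Ψ : Fin 3 → V →ₗ[ℝ] V) (c : Fin 3 → ℝ) (v : V) :
    Fintype.linearCombination ℝ (fun i => Ψ i v) c = Fintype.linearCombination ℝ Ψ c v := by
  simp only [Fintype.linearCombination_apply, LinearMap.sum_apply, LinearMap.smul_apply]

theorem quadCurv_lorentz (g : LinearMap.BilinForm ℝ V) (Ψ : Fin 3 → V →ₗ[ℝ] V) :
    quadCurv g lorentz Ψ =
      endoCurv g (Ψ 0) + (-1 : ℝ) • endoCurv g (Ψ 1) + (-1 : ℝ) • endoCurv g (Ψ 2) := by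
  simp only [lorentz, quadCurv_diagonal, Fin.sum_univ_three, cons_val, one_smul]

namespace IsCliffordTriple

theorem comp_self (h : IsCliffordTriple g Ψ) (i : Fin 3) :
    Ψ i ∘ₗ Ψ i = (-lorentz i i) • LinearMap.id := by
  have hii := h.anticomm i i
  rw [← two_smul ℝ, neg_mul, ← mul_neg, mul_smul] at hii
  exact smul_right_injective _ two_ne_zero hii

theorem isParaquaternionic (h : IsCliffordTriple g Ψ) :
    IsParaquaternionic g (Ψ 0) (Ψ 1) (Ψ 2) where
  complex₁ := ⟨h.skew 0, by simp [h.comp_self, lorentz]⟩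
  para₂ := ⟨h.skew 1, by simp [h.comp_self, lorentz]⟩
  para₃ := ⟨h.skew 2, by simp [h.comp_self, lorentz]⟩
  anti₁₂ := by simp [h.anticomm, lorentz]
  anti₁₃ := by simp [h.anticomm, lorentz]
  anti₂₃ := by simp [h.anticomm, lorentz]

theorem isSkewAdjoint_linearCombination (h : IsCliffordTriple g Ψ) (c : Fin 3 → ℝ) :
    g.IsSkewAdjoint (Fintype.linearCombination ℝ Ψ c) :=
  isSkewAdjoint_iff.2 fun x y => by
    simp only [Fintype.linearCombination_apply, LinearMap.sum_apply, LinearMap.smul_apply, map_sum,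
      map_smul, isSkewAdjoint_iff.1 (h.skew _) x y, smul_neg, Finset.sum_neg_distrib]

theorem linearCombination_anticomm (h : IsCliffordTriple g Ψ) (c d : Fin 3 → ℝ) :
    Fintype.linearCombination ℝ Ψ c ∘ₗ Fintype.linearCombination ℝ Ψ d +
      Fintype.linearCombination ℝ Ψ d ∘ₗ Fintype.linearCombination ℝ Ψ c =
        (-2 * (c ⬝ᵥ lorentz *ᵥ d)) • LinearMap.id := by
  calc _ = ∑ i, ∑ j, (c i * d j) • (Ψ i ∘ₗ Ψ j + Ψ j ∘ₗ Ψ i) := by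
        ext x
        simp only [Fintype.linearCombination_apply, LinearMap.add_apply, LinearMap.comp_apply,
          LinearMap.sum_apply, LinearMap.smul_apply, map_sum, map_smul, smul_add,
          Finset.sum_add_distrib, Finset.smul_sum, smul_smul]
        congr 1
        rw [Finset.sum_comm]
        simp only [mul_comm]
    _ = _ := by
        simp only [h.anticomm, smul_smul, ← Finset.sum_smul, dotProduct, mulVec, Finset.mul_sum]
        congr 1
        exact Finset.sum_congr rfl fun i _ => Finset.sum_congr rfl fun j _ => by ring

theorem linearCombination_apply_self (h : IsCliffordTriple g Ψ) (c : Fin 3 → ℝ) (x : V) :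
    Fintype.linearCombination ℝ Ψ c (Fintype.linearCombination ℝ Ψ c x) =
      -lorentzNorm c • x := by
  have hcc := LinearMap.congr_fun (h.linearCombination_anticomm c c) x
  rw [← two_smul ℝ, neg_mul, ← mul_neg, mul_smul, dotProduct_lorentz_mulVec] at hcc
  exact smul_right_injective _ two_ne_zero hcc

theorem congr (h : IsCliffordTriple g Ψ) {X : Matrix (Fin 3) (Fin 3) ℝ} (hX : IsLorentzFrame X) :
    IsCliffordTriple g fun k => Fintype.linearCombination ℝ Ψ (X k) where
  skew k := h.isSkewAdjoint_linearCombination (X k)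
  anticomm k l := by
    rw [h.linearCombination_anticomm, ← congrFun₂ hX k l, Matrix.mul_assoc]
    rfl

theorem form_apply_apply (h : IsCliffordTriple g Ψ) (hg : g.IsSymm) (i j : Fin 3) (x : V) :
    g (Ψ i x) (Ψ j x) = lorentz i j * g x x := by
  have hij := congrArg (g x) (LinearMap.congr_fun (h.anticomm i j) x)
  simp only [LinearMap.add_apply, LinearMap.comp_apply, LinearMap.smul_apply, LinearMap.id_apply,
    map_add, map_smul, smul_eq_mul] at hij
  linarith [isSkewAdjoint_iff.1 (h.skew i) x (Ψ j x), isSkewAdjoint_iff.1 (h.skew j) x (Ψ i x),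
    hg.eq (Ψ i x) (Ψ j x)]

theorem exists_apply_eq_zero (h : IsCliffordTriple g Ψ) [Nontrivial V] {n : Fin 3 → ℝ}
    (hn : n ≠ 0) (hnull : lorentzNorm n = 0) :
    ∃ v ≠ 0, g v v = 0 ∧ Fintype.linearCombination ℝ Ψ n v = 0 := by
  set N := Fintype.linearCombination ℝ Ψ n
  have hNN : ∀ x, N (N x) = 0 := fun x => by
    rw [h.linearCombination_apply_self, hnull, neg_zero, zero_smul]
  obtain ⟨w, hw⟩ : ∃ w, N w ≠ 0 := by
    by_contra! hN
    obtain ⟨x, hx⟩ := exists_ne (0 : V)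
    have hd := LinearMap.congr_fun (h.linearCombination_anticomm n (lorentz *ᵥ n)) x
    rw [lorentz_mulVec_lorentz_mulVec, LinearMap.add_apply, LinearMap.comp_apply,
      LinearMap.comp_apply, hN, hN, map_zero, add_zero, LinearMap.smul_apply,
      LinearMap.id_apply, eq_comm] at hd
    simp [hx, hn] at hd
  exact ⟨N w, hw, by
    rw [isSkewAdjoint_iff.1 (h.isSkewAdjoint_linearCombination n), hNN, map_zero, neg_zero], hNN w⟩

theorem lorentzNorm_eq_zero (h : IsCliffordTriple g Ψ) (hv : v ≠ 0) {c : Fin 3 → ℝ}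
    (hc : Fintype.linearCombination ℝ Ψ c v = 0) : lorentzNorm c = 0 := by
  have hsq := h.linearCombination_apply_self c v
  rw [hc, map_zero] at hsq
  simpa [hv] using hsq.symm

theorem finrank_ker_linearCombination_le_one (h : IsCliffordTriple g Ψ) (hv : v ≠ 0) :
    finrank ℝ (LinearMap.ker (Fintype.linearCombination ℝ fun i => Ψ i v)) ≤ 1 := by
  set K := LinearMap.ker (Fintype.linearCombination ℝ fun i => Ψ i v)
  have hinj : Function.Injective ((LinearMap.proj 0 : (Fin 3 → ℝ) →ₗ[ℝ] ℝ) ∘ₗ K.subtype) := by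
    rw [injective_iff_map_eq_zero]
    rintro ⟨c, hc⟩ (h0 : c 0 = 0)
    have hnull := h.lorentzNorm_eq_zero hv ((linearCombination_apply Ψ c v).symm.trans hc)
    rw [lorentzNorm, h0] at hnull
    ext i
    fin_cases i
    · exact h0
    · exact pow_eq_zero_iff two_ne_zero |>.1 (by nlinarith : c 1 ^ 2 = 0)
    · exact pow_eq_zero_iff two_ne_zero |>.1 (by nlinarith : c 2 ^ 2 = 0)
  simpa using LinearMap.finrank_le_finrank_of_injective hinj

theorem linearCombination_apply_eq_zero_iff (h : IsCliffordTriple g Ψ) (hv : v ≠ 0)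
    {n : Fin 3 → ℝ} (hn : n ≠ 0) (hnv : Fintype.linearCombination ℝ Ψ n v = 0) {c : Fin 3 → ℝ} :
    Fintype.linearCombination ℝ Ψ c v = 0 ↔ ∃ t : ℝ, c = t • n := by
  refine ⟨fun hc => ?_, by rintro ⟨t, rfl⟩; simp [hnv]⟩
  rw [← linearCombination_apply] at hc hnv
  have hn' : (⟨n, hnv⟩ : LinearMap.ker (Fintype.linearCombination ℝ fun i => Ψ i v)) ≠ 0 :=
    fun h0 => hn (congrArg Subtype.val h0)
  obtain ⟨t, ht⟩ := exists_smul_eq_of_finrank_eq_one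
    ((h.finrank_ker_linearCombination_le_one hv).antisymm
      (finrank_pos_iff_exists_ne_zero.2 ⟨_, hn'⟩)) hn' ⟨c, hc⟩
  exact ⟨t, (congrArg Subtype.val ht).symm⟩

variable [FiniteDimensional ℝ V]

theorem finrank_range_linearCombination (h : IsCliffordTriple g Ψ) (hg : g.IsSymm)
    (hnd : g.Nondegenerate) (hdim : finrank ℝ V = 4) (hv : v ≠ 0) (hvv : g v v = 0) :
    finrank ℝ (LinearMap.range (Fintype.linearCombination ℝ fun i => Ψ i v)) = 2 := by
  have hiso : LinearMap.range (Fintype.linearCombination ℝ fun i => Ψ i v) ≤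
      LinearMap.ker (pairing g fun i => Ψ i v) := by
    rintro _ ⟨c, rfl⟩
    exact pairing_linearCombination_of_isotropic
      (fun i j => by rw [h.form_apply_apply hg, hvv, mul_zero]) c
  have hle := Submodule.finrank_mono hiso
  have hpair := finrank_range_pairing hnd fun i => Ψ i v
  have hrk := (pairing g fun i => Ψ i v).finrank_range_add_finrank_ker
  have hrkL := (Fintype.linearCombination ℝ fun i => Ψ i v).finrank_range_add_finrank_ker
  have hker := h.finrank_ker_linearCombination_le_one hv
  rw [finrank_fin_fun] at hrkL
  omega

theorem exists_null_apply_eq_zero (h : IsCliffordTriple g Ψ) (hg : g.IsSymm)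
    (hnd : g.Nondegenerate) (hdim : finrank ℝ V = 4) (hv : v ≠ 0) (hvv : g v v = 0) :
    ∃ n ≠ 0, lorentzNorm n = 0 ∧ Fintype.linearCombination ℝ Ψ n v = 0 := by
  have hrk := (Fintype.linearCombination ℝ fun i => Ψ i v).finrank_range_add_finrank_ker
  rw [h.finrank_range_linearCombination hg hnd hdim hv hvv, finrank_fin_fun] at hrk
  obtain ⟨⟨n, hn⟩, hn0⟩ := finrank_pos_iff_exists_ne_zero.1
    (show 0 < finrank ℝ (LinearMap.ker (Fintype.linearCombination ℝ fun i => Ψ i v)) by omega)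
  have hnv := (linearCombination_apply Ψ n v).symm.trans hn
  exact ⟨n, fun h0 => hn0 (Subtype.ext h0), h.lorentzNorm_eq_zero hv hnv, hnv⟩

theorem exists_pairing_eq_iff (h : IsCliffordTriple g Ψ) (hg : g.IsSymm)
    (hnd : g.Nondegenerate) (hdim : finrank ℝ V = 4) (hv : v ≠ 0) (hvv : g v v = 0)
    {n : Fin 3 → ℝ} (hn : n ≠ 0) (hnv : Fintype.linearCombination ℝ Ψ n v = 0) {u : Fin 3 → ℝ} :
    (∃ y, pairing g (fun i => Ψ i v) y = u) ↔ u ⬝ᵥ n = 0 := by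
  set f : Dual ℝ (Fin 3 → ℝ) := dotProductEquiv ℝ (Fin 3) n
  have hf : f ≠ 0 := (LinearEquiv.map_ne_zero_iff _).2 hn
  have hle : LinearMap.range (pairing g fun i => Ψ i v) ≤ LinearMap.ker f := by
    rintro _ ⟨y, rfl⟩
    change n ⬝ᵥ pairing g (fun i => Ψ i v) y = 0
    rw [← form_linearCombination, linearCombination_apply, hnv, LinearMap.map_zero₂]
  have heq : LinearMap.range (pairing g fun i => Ψ i v) = LinearMap.ker f := by
    refine Submodule.eq_of_le_of_finrank_eq hle ?_
    have hker := Dual.finrank_ker_add_one_of_ne_zero hf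
    rw [finrank_fin_fun] at hker
    rw [finrank_range_pairing hnd, h.finrank_range_linearCombination hg hnd hdim hv hvv]
    omega
  rw [dotProduct_comm]
  exact SetLike.ext_iff.1 heq u

theorem finrank_ker_quadOp_eq_two_iff (h : IsCliffordTriple g Ψ) (hg : g.IsSymm)
    (hnd : g.Nondegenerate) (hdim : finrank ℝ V = 4) (hv : v ≠ 0) (hvv : g v v = 0)
    {n : Fin 3 → ℝ} (hn : n ≠ 0) (hnv : Fintype.linearCombination ℝ Ψ n v = 0)
    (m : Matrix (Fin 3) (Fin 3) ℝ) :
    finrank ℝ (LinearMap.ker (quadOp g m fun i => Ψ i v)) = 2 ↔ adjForm m n ≠ 0 := by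
  have hle : LinearMap.ker (pairing g fun i => Ψ i v) ≤
      LinearMap.ker (quadOp g m fun i => Ψ i v) := fun y hy => by
    rw [LinearMap.mem_ker, quadOp, LinearMap.comp_apply, LinearMap.comp_apply,
      LinearMap.mem_ker.1 hy, map_zero, map_zero]
  have hker : finrank ℝ (LinearMap.ker (pairing g fun i => Ψ i v)) = 2 := by
    have hrk := (pairing g fun i => Ψ i v).finrank_range_add_finrank_ker
    rw [finrank_range_pairing hnd, h.finrank_range_linearCombination hg hnd hdim hv hvv] at hrk
    omega
  have hmem : ∀ y, quadOp g m (fun i => Ψ i v) y = 0 ↔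
      ∃ t : ℝ, m *ᵥ pairing g (fun i => Ψ i v) y = t • n := fun y => by
    rw [← h.linearCombination_apply_eq_zero_iff hv hn hnv, ← linearCombination_apply]
    rfl
  rw [Ne, adjForm_eq_zero_iff hn]
  constructor
  · rintro h2 ⟨u, hu0, hun, hu⟩
    obtain ⟨y, rfl⟩ := (h.exists_pairing_eq_iff hg hnd hdim hv hvv hn hnv).2 hun
    have heq := Submodule.eq_of_le_of_finrank_eq hle (hker.trans h2.symm)
    exact hu0 (heq.ge ((hmem y).2 hu))
  · intro hno
    have hge : LinearMap.ker (quadOp g m fun i => Ψ i v) ≤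
        LinearMap.ker (pairing g fun i => Ψ i v) := fun y hy => by
      by_contra hy0
      exact hno ⟨_, hy0, (h.exists_pairing_eq_iff hg hnd hdim hv hvv hn hnv).1 ⟨y, rfl⟩,
        (hmem y).1 hy⟩
    rw [hge.antisymm hle, hker]

end IsCliffordTriple

end Clifford

/-! ### Null Jordan Osserman tensors of Clifford type -/

namespace Model

variable [FiniteDimensional ℝ V] {M : Model V}

theorem isNullJordanOsserman_of_curv_eq_smul_constCurv {κ : ℝ}
    (hA : M.curv = κ • constCurv M.form) : M.IsNullJordanOsserman := by
  refine isNullJordanOsserman_of_jacobi_eq_quadOp (diagonal ![-κ]) (fun v => ![v]) ?_ ?_ ?_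
  · rintro v ⟨hv, -⟩
    exact LinearIndependent.of_subsingleton (v := ![v]) 0 hv
  · rintro v ⟨-, hvv⟩
    simp [hvv]
  · rintro v ⟨-, hvv⟩
    refine M.jacobi_eq_iff.2 fun y z => ?_
    simp [quadOp_apply, mulVec_diagonal, hA, constCurv_apply, hvv, M.form_symm.eq y v, mul_assoc]

theorem isNullJordanOsserman_of_curv_eq_add_isOrthogonalComplex {κ κ' : ℝ} {J : V →ₗ[ℝ] V}
    (hJ : IsOrthogonalComplex M.form J)
    (hA : M.curv = κ • constCurv M.form + κ' • endoCurv M.form J) : M.IsNullJordanOsserman := by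
  have hJJ : ∀ x, J (J x) = -x := LinearMap.congr_fun hJ.2
  have hskew := isSkewAdjoint_iff.1 hJ.1
  have hself := form_skewAdjoint_self M.form_symm hJ.1
  refine isNullJordanOsserman_of_jacobi_eq_quadOp (diagonal ![-κ, 3 * κ'])
    (fun v => ![v, J v]) ?_ ?_ ?_
  · rintro v ⟨hv, -⟩
    refine LinearIndependent.pair_iff.2 fun s t hst => ?_
    have hst' : s • J v - t • v = 0 := by simpa [hJJ, sub_eq_add_neg] using congrArg J hst
    have hsq : (s ^ 2 + t ^ 2) • v = 0 := by linear_combination (norm := module) s • hst - t • hst'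
    have hst0 := (smul_eq_zero.1 hsq).resolve_right hv
    constructor <;> nlinarith
  · rintro v ⟨-, hvv⟩
    have hvJ : M.form v (J v) = 0 := (M.form_symm.eq _ _).trans (hself v)
    simp [Fin.forall_fin_two, hvv, hvJ, hskew, hJJ]
  · rintro v ⟨-, hvv⟩
    refine M.jacobi_eq_iff.2 fun y z => ?_
    simp only [quadOp_apply, mulVec_diagonal, pairing_apply, Fin.sum_univ_two, cons_val_zero,
      cons_val_one, cons_val_fin_one, map_add, map_smul, LinearMap.add_apply,
      LinearMap.smul_apply, smul_eq_mul, hA, constCurv_apply, hvv, M.form_symm.eq y v,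
      endoCurv_apply, hself, hskew y, M.form_symm.eq y (J v)]
    ring

theorem isNullJordanOsserman_of_curv_eq_smul_isAdaptedParacomplex {κ : ℝ} {P : V →ₗ[ℝ] V}
    (hP : IsAdaptedParacomplex M.form P) (hA : M.curv = κ • endoCurv M.form P) :
    M.IsNullJordanOsserman := by
  have hPP : ∀ x, P (P x) = x := LinearMap.congr_fun hP.2
  have hskew := isSkewAdjoint_iff.1 hP.1
  refine isNullJordanOsserman_of_jacobi_eq_quadOp (diagonal ![3 * κ]) (fun v => ![P v]) ?_ ?_ ?_
  · rintro v ⟨hv, -⟩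
    exact LinearIndependent.of_subsingleton (v := ![P v]) 0 fun h => hv (by
      rw [← hPP v]; exact (congrArg P h).trans (map_zero P))
  · rintro v ⟨-, hvv⟩
    simp [hskew, hPP, hvv]
  · rintro v -
    refine M.jacobi_eq_iff.2 fun y z => ?_
    simp only [quadOp_apply, mulVec_diagonal, pairing_apply, Fin.sum_univ_one, cons_val_zero,
      map_smul, LinearMap.smul_apply, smul_eq_mul, hA, endoCurv_apply,
      form_skewAdjoint_self M.form_symm hP.1, hskew y, M.form_symm.eq y (P v)]
    ring

end Model

section Paraquaternionic

variable [FiniteDimensional ℝ V] {M : Model V} {Ψ : Fin 3 → V →ₗ[ℝ] V} {κ : Fin 3 → ℝ}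

theorem IsCliffordTriple.isNullJordanOsserman (h : IsCliffordTriple M.form Ψ)
    (hdim : finrank ℝ V = 4) {m : Matrix (Fin 3) (Fin 3) ℝ} (hm : m.IsSymm)
    (hA : M.curv = quadCurv M.form m Ψ) (hnull : IsNullNondegenerate m) :
    M.IsNullJordanOsserman := by
  have hJ := Model.jacobi_quadCurv hm h.skew hA
  have hker : ∀ v ∈ M.nullCone, finrank ℝ (LinearMap.ker (M.jacobi v)) = 2 := by
    rintro v ⟨hv, hvv⟩
    obtain ⟨n, hn, hnn, hnv⟩ :=
      h.exists_null_apply_eq_zero M.form_symm M.form_nondegenerate hdim hv hvv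
    rw [hJ, LinearMap.ker_smul _ _ three_ne_zero, h.finrank_ker_quadOp_eq_two_iff M.form_symm
      M.form_nondegenerate hdim hv hvv hn hnv]
    exact hnull n hn hnn
  have hsq : ∀ v ∈ M.nullCone, M.jacobi v ∘ₗ M.jacobi v = 0 := by
    rintro v ⟨-, hvv⟩
    rw [hJ, LinearMap.smul_comp, LinearMap.comp_smul, quadOp_comp_self_of_isotropic
      (fun i j => by rw [h.form_apply_apply M.form_symm, hvv, mul_zero]), smul_zero, smul_zero]
  exact fun v hv w hw =>
    exists_conj_of_comp_self_eq_zero (hsq v hv) (hsq w hw) ((hker v hv).trans (hker w hw).symm)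

theorem IsCliffordTriple.exists_basis_perp (h : IsCliffordTriple M.form Ψ)
    (hdim : finrank ℝ V = 4) {x : V} (hx : M.form x x ≠ 0) :
    ∃ b : Basis (Fin 3) ℝ (M.perp x), ∀ i, (b i : V) = Ψ i x := by
  have hperp : finrank ℝ (M.perp x) = 3 := by
    have hx0 : M.form x ≠ 0 := fun h0 => hx (by rw [h0, LinearMap.zero_apply])
    have hker := Dual.finrank_ker_add_one_of_ne_zero hx0
    rw [hdim] at hker
    exact Nat.succ_injective hker
  let f : Fin 3 → M.perp x := fun i =>
    ⟨Ψ i x, (M.form_symm.eq _ _).trans (form_skewAdjoint_self M.form_symm (h.skew i) x)⟩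
  have hind : LinearIndependent ℝ f := by
    refine .of_comp (M.perp x).subtype ?_
    refine LinearMap.linearIndependent_of_isOrthoᵢ (B := M.form) (fun i j hij => ?_) fun i => ?_
    · exact (h.form_apply_apply M.form_symm i j x).trans (by simp [lorentz, hij])
    · refine (h.form_apply_apply M.form_symm i i x).trans_ne ?_
      fin_cases i <;> simp [lorentz, hx]
  exact ⟨basisOfLinearIndependentOfCardEqFinrank hind (by simp [hperp]), by simp [f]⟩

theorem IsCliffordTriple.isDiagonalOn (h : IsCliffordTriple M.form Ψ) (hdim : finrank ℝ V = 4)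
    (hA : M.curv = quadCurv M.form (diagonal κ) Ψ) {ε : ℝ} (hε : ε ≠ 0) :
    M.IsDiagonalOn {x | M.form x x = ε} := by
  let d : Fin 3 → ℝ := fun k => 3 * (κ k * (lorentz k k * ε))
  refine ⟨d 0, d 1, d 2, fun x (hx : M.form x x = ε) => ?_⟩
  obtain ⟨b, hb⟩ := h.exists_basis_perp hdim (hx ▸ hε)
  have heigen : ∀ k, M.jacobiPerp x (b k) = d k • b k := fun k => by
    ext
    rw [Model.jacobiPerp, LinearMap.coe_restrict_apply, Submodule.coe_smul, hb,
      Model.jacobi_quadCurv (isSymm_diagonal κ) h.skew hA, LinearMap.smul_apply, quadOp_apply,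
      Finset.sum_eq_single k, mulVec_diagonal, pairing_apply, h.form_apply_apply M.form_symm, hx,
      smul_smul]
    · intro i _ hik
      rw [mulVec_diagonal, pairing_apply, h.form_apply_apply M.form_symm, lorentz,
        diagonal_apply_ne _ hik, zero_mul, mul_zero, zero_smul]
    · simp
  have hd : ![d 0, d 1, d 2] = d := by ext i; fin_cases i <;> rfl
  refine ⟨b, ?_⟩
  rw [hd]
  ext i j
  rw [LinearMap.toMatrix_apply, heigen, map_smul, Basis.repr_self, diagonal_apply]
  rcases eq_or_ne i j with rfl | hij
  · simp
  · simp [hij]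

theorem IsCliffordTriple.isTypeIa (h : IsCliffordTriple M.form Ψ) (hdim : finrank ℝ V = 4)
    (hA : M.curv = quadCurv M.form (diagonal κ) Ψ) : M.IsTypeIa :=
  ⟨h.isDiagonalOn hdim hA one_ne_zero, h.isDiagonalOn hdim hA (neg_ne_zero.2 one_ne_zero)⟩

end Paraquaternionic

/-! ### Null frames -/

namespace Model.HasSignature

variable [FiniteDimensional ℝ V] {M : Model V}

theorem exists_isOrthoᵢ (h : M.HasSignature 2 2) :
    ∃ f : Fin 4 → V, M.form.IsOrthoᵢ f ∧ 0 < M.form (f 0) (f 0) ∧ 0 < M.form (f 1) (f 1) ∧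
      M.form (f 2) (f 2) < 0 ∧ M.form (f 3) (f 3) < 0 := by
  obtain ⟨hneg, hpos⟩ := h
  set Q := LinearMap.BilinMap.toQuadraticMap M.form
  have hassoc : QuadraticMap.associated Q = M.form :=
    QuadraticMap.associated_left_inverse _ M.form_symm.eq
  obtain ⟨v, hv⟩ := LinearMap.BilinForm.exists_orthogonal_basis
    (LinearMap.BilinForm.isSymm_iff.1 M.form_symm)
  have hE : QuadraticMap.Equivalent Q _ :=
    ⟨QuadraticForm.isometryEquivWeightedSumSquares Q v (by rwa [hassoc])⟩
  rw [QuadraticForm.sigPos_of_equiv_weightedSumSquares hE] at hpos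
  rw [QuadraticForm.sigNeg_of_equiv_weightedSumSquares hE] at hneg
  obtain ⟨i, j, hij, hI⟩ := Set.ncard_eq_two.1 hpos
  obtain ⟨k, l, hkl, hK⟩ := Set.ncard_eq_two.1 hneg
  have hi : 0 < Q (v i) := hI.ge (by simp)
  have hj : 0 < Q (v j) := hI.ge (by simp)
  have hk : Q (v k) < 0 := hK.ge (by simp)
  have hl : Q (v l) < 0 := hK.ge (by simp)
  have hf : Function.Injective ![i, j, k, l] := by
    have hik : i ≠ k := by rintro rfl; exact lt_asymm hi hk
    have hil : i ≠ l := by rintro rfl; exact lt_asymm hi hl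
    have hjk : j ≠ k := by rintro rfl; exact lt_asymm hj hk
    have hjl : j ≠ l := by rintro rfl; exact lt_asymm hj hl
    intro a c hac
    fin_cases a <;> fin_cases c <;> simp_all
  exact ⟨v ∘ ![i, j, k, l], fun a c hac => hv (hf.ne hac), hi, hj, hk, hl⟩

theorem exists_orthonormal (h : M.HasSignature 2 2) :
    ∃ e : Fin 4 → V, ∀ i j, M.form (e i) (e j) = diagonal ![1, 1, -1, -1] i j := by
  obtain ⟨f, hf, h0, h1, h2, h3⟩ := h.exists_isOrthoᵢ
  have hsign : ∀ a, M.form (f a) (f a) / |M.form (f a) (f a)| = ![1, 1, -1, -1] a := by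
    simp [Fin.forall_fin_succ, abs_of_pos, abs_of_neg, h0, h1, h2, h3, h0.ne', h1.ne', h2.ne, h3.ne]
  refine ⟨fun a => (√|M.form (f a) (f a)|)⁻¹ • f a, fun a c => ?_⟩
  rw [map_smul, map_smul, LinearMap.smul_apply, smul_eq_mul, smul_eq_mul]
  rcases eq_or_ne a c with rfl | hac
  · rw [diagonal_apply_eq, ← hsign, ← mul_assoc, ← mul_inv, Real.mul_self_sqrt (abs_nonneg _),
      inv_mul_eq_div]
  · rw [diagonal_apply_ne _ hac, hf hac, mul_zero, mul_zero]

end Model.HasSignature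

/-- A null frame of a neutral four-dimensional space: two hyperbolic pairs `(b 0, b 3)` and
`(b 1, -b 2)` that are orthogonal to each other. -/
def IsNullFrame (g : LinearMap.BilinForm ℝ V) (b : Fin 4 → V) : Prop :=
  ∀ i j, g (b i) (b j) = !![0, 0, 0, 1; 0, 0, -1, 0; 0, -1, 0, 0; 1, 0, 0, 0] i j

/-- The frame dual to a null frame `b`: the form of `b i` and `dualFrame b j` is `δᵢⱼ`. -/
def dualFrame (b : Fin 4 → V) : Fin 4 → V := ![b 3, -b 2, -b 1, b 0]

theorem Model.HasSignature.exists_isNullFrame [FiniteDimensional ℝ V] {M : Model V}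
    (h : M.HasSignature 2 2) : ∃ b, IsNullFrame M.form b := by
  obtain ⟨e, he⟩ := h.exists_orthonormal
  refine ⟨![(1 / 2 : ℝ) • (e 0 + e 2), (1 / 2 : ℝ) • (e 1 + e 3), e 3 - e 1, e 0 - e 2],
    fun i j => ?_⟩
  fin_cases i <;> fin_cases j <;> simp [he, diagonal] <;> norm_num

namespace IsNullFrame

variable {g : LinearMap.BilinForm ℝ V} {b : Fin 4 → V}

theorem form_sum_dualFrame (h : IsNullFrame g b) (c : Fin 4 → ℝ) (j : Fin 4) :
    g (∑ i, c i • b i) (dualFrame b j) = c j := by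
  fin_cases j <;> simp [dualFrame, Fin.sum_univ_four, h _ _]

theorem linearIndependent (h : IsNullFrame g b) : LinearIndependent ℝ b :=
  Fintype.linearIndependent_iff.2 fun c hc j => by
    rw [← h.form_sum_dualFrame c j, hc, LinearMap.map_zero₂]

/-- The basis underlying a null frame. -/
noncomputable def basis (h : IsNullFrame g b) (hdim : finrank ℝ V = 4) : Basis (Fin 4) ℝ V :=
  basisOfLinearIndependentOfCardEqFinrank h.linearIndependent (by simp [hdim])

@[simp]
theorem coe_basis (h : IsNullFrame g b) (hdim : finrank ℝ V = 4) : ⇑(h.basis hdim) = b := by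
  simp [basis]

theorem basis_repr_apply (h : IsNullFrame g b) (hdim : finrank ℝ V = 4) (x : V) (i : Fin 4) :
    (h.basis hdim).repr x i = g x (dualFrame b i) := by
  conv_rhs => rw [← (h.basis hdim).sum_repr x]
  rw [coe_basis, h.form_sum_dualFrame]

theorem form_eq_sum (h : IsNullFrame g b) (hdim : finrank ℝ V = 4) (x y : V) :
    g x y = ∑ i, g x (dualFrame b i) * g (b i) y := by
  conv_lhs => rw [← (h.basis hdim).sum_repr x]
  simp only [coe_basis, basis_repr_apply, map_sum, map_smul, LinearMap.sum_apply,
    LinearMap.smul_apply, smul_eq_mul]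

theorem trace_eq_sum (h : IsNullFrame g b) (hdim : finrank ℝ V = 4) (T : V →ₗ[ℝ] V) :
    LinearMap.trace ℝ V T = ∑ i, g (T (b i)) (dualFrame b i) := by
  simp only [LinearMap.trace_eq_matrix_trace ℝ (h.basis hdim), Matrix.trace, Matrix.diag,
    LinearMap.toMatrix_apply, basis_repr_apply, coe_basis]

theorem swap (h : IsNullFrame g b) : IsNullFrame g ![b 0, b 2, b 1, b 3] := by
  intro i j
  fin_cases i <;> fin_cases j <;> simp [h _ _]

theorem rotate (h : IsNullFrame g b) {α β γ δ : ℝ} (hdet : α * δ - β * γ = 1) :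
    IsNullFrame g
      ![α • b 0 + γ • b 2, α • b 1 + γ • b 3, β • b 0 + δ • b 2, β • b 1 + δ • b 3] := by
  intro i j
  fin_cases i <;> fin_cases j <;> simp [h _ _] <;> linarith

theorem exists_eq_smul_of_forall_null (h : IsNullFrame g b) (hdim : finrank ℝ V = 4)
    {S : LinearMap.BilinForm ℝ V} (hS : S.IsSymm) (hnull : ∀ v, g v v = 0 → S v v = 0) :
    ∃ c : ℝ, S = c • g := by
  have hquad : ∀ p q r s : ℝ, p * s = q * r →
      p ^ 2 * S (b 0) (b 0) + q ^ 2 * S (b 1) (b 1) + r ^ 2 * S (b 2) (b 2) +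
        s ^ 2 * S (b 3) (b 3) + 2 * (p * q * S (b 0) (b 1) + p * r * S (b 0) (b 2) +
        p * s * S (b 0) (b 3) + q * r * S (b 1) (b 2) + q * s * S (b 1) (b 3) +
        r * s * S (b 2) (b 3)) = 0 := fun p q r s hpqrs => by
    have hv := hnull (p • b 0 + q • b 1 + r • b 2 + s • b 3) (by
      simp only [map_add, map_smul, LinearMap.add_apply, LinearMap.smul_apply, smul_eq_mul, h _ _,
        of_apply, cons_val', cons_val, cons_val_fin_one]
      linear_combination 2 * hpqrs)
    simp only [map_add, map_smul, LinearMap.add_apply, LinearMap.smul_apply, smul_eq_mul] at hv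
    linear_combination hv + p * q * hS.eq (b 0) (b 1) + p * r * hS.eq (b 0) (b 2) +
      p * s * hS.eq (b 0) (b 3) + q * r * hS.eq (b 1) (b 2) + q * s * hS.eq (b 1) (b 3) +
      r * s * hS.eq (b 2) (b 3)
  have h0 := hquad 1 0 0 0 (by norm_num)
  have h1 := hquad 0 1 0 0 (by norm_num)
  have h2 := hquad 0 0 1 0 (by norm_num)
  have h3 := hquad 0 0 0 1 (by norm_num)
  have h01 := hquad 1 1 0 0 (by norm_num)
  have h02 := hquad 1 0 1 0 (by norm_num)
  have h13 := hquad 0 1 0 1 (by norm_num)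
  have h23 := hquad 0 0 1 1 (by norm_num)
  have h0123 := hquad 1 1 1 1 (by norm_num)
  refine ⟨S (b 0) (b 3), (h.basis hdim).ext fun i => (h.basis hdim).ext fun j => ?_⟩
  rw [coe_basis, LinearMap.smul_apply, LinearMap.smul_apply, smul_eq_mul, h]
  fin_cases i <;> fin_cases j <;> simp [-neg_mul] <;>
    linarith [hS.eq (b 0) (b 1), hS.eq (b 0) (b 2), hS.eq (b 0) (b 3), hS.eq (b 1) (b 2),
      hS.eq (b 1) (b 3), hS.eq (b 2) (b 3)]

variable (h : IsNullFrame g b) (hdim : finrank ℝ V = 4)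

/-- The standard paraquaternionic structure of a null frame, acting on the first factor of
`V ≅ ℝ² ⊗ ℝ²`. -/
noncomputable def para (h : IsNullFrame g b) (hdim : finrank ℝ V = 4) (i : Fin 3) : V →ₗ[ℝ] V :=
  (h.basis hdim).constr ℝ
    (![![b 2, b 3, -b 0, -b 1], ![b 0, b 1, -b 2, -b 3], ![b 2, b 3, b 0, b 1]] i)

theorem para_apply (i : Fin 3) (k : Fin 4) :
    h.para hdim i (b k) =
      ![![b 2, b 3, -b 0, -b 1], ![b 0, b 1, -b 2, -b 3], ![b 2, b 3, b 0, b 1]] i k := by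
  have hk := (h.basis hdim).constr_basis ℝ
    (![![b 2, b 3, -b 0, -b 1], ![b 0, b 1, -b 2, -b 3], ![b 2, b 3, b 0, b 1]] i) k
  rwa [coe_basis] at hk

theorem isCliffordTriple_para : IsCliffordTriple g (h.para hdim) where
  skew i := by
    suffices g ∘ₗ h.para hdim i = -(g.compl₂ (h.para hdim i)) from
      isSkewAdjoint_iff.2 (LinearMap.congr_fun₂ this)
    refine (h.basis hdim).ext fun k => (h.basis hdim).ext fun l => ?_
    simp only [coe_basis, LinearMap.comp_apply, LinearMap.neg_apply, LinearMap.compl₂_apply,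
      para_apply]
    fin_cases i <;> fin_cases k <;> fin_cases l <;> simp [h _ _]
  anticomm i j := by
    refine (h.basis hdim).ext fun k => ?_
    fin_cases i <;> fin_cases j <;> fin_cases k <;> simp [para_apply, lorentz] <;> module

theorem quadCurv_lorentz_para (hg : g.IsSymm) :
    quadCurv g lorentz (h.para hdim) = (3 : ℝ) • constCurv g := by
  refine (isAlgebraicCurvatureTensor_quadCurv hg (isSymm_diagonal _)
    (h.isCliffordTriple_para hdim).skew).ext_of_basis
    ((isAlgebraicCurvatureTensor_constCurv hg).smul 3) (h.basis hdim) fun i j k l hij hkl hle => ?_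
  rw [coe_basis, quadCurv_apply]
  fin_cases i <;> fin_cases j <;> try (exact absurd hij (by decide))
  all_goals fin_cases k <;> fin_cases l <;> try (exact absurd hkl (by decide))
  all_goals try (exact absurd hle (by decide))
  all_goals simp [Fin.sum_univ_three, para_apply, h _ _] <;> norm_num

end IsNullFrame

/-! ### Vanishing of half of the Weyl tensor -/

theorem exists_mul_sub_mul_eq_one {K : Type*} [Field K] {a c : K} (h : ¬(a = 0 ∧ c = 0)) :
    ∃ b d : K, a * d - b * c = 1 := by
  by_cases ha : a = 0
  · exact ⟨-c⁻¹, 0, by grind⟩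
  · exact ⟨0, a⁻¹, by simp [ha]⟩

theorem IsAlgebraicCurvatureTensor.coeff_eq_zero_of_forall_apply_eq_zero {A : Tensor4 V}
    (hA : IsAlgebraicCurvatureTensor A) {x y z w : V}
    (h : ∀ p q : ℝ, A (p • x + q • y) (p • z + q • w) (p • x + q • y) (p • z + q • w) = 0) :
    A x z x z = 0 ∧ A x z x w + A x z y z = 0 ∧ A y w y w = 0 ∧ A x w y w + A y z y w = 0 ∧
      A x w x w + A y z y z + 2 * A x z y w + 2 * A x w y z = 0 := by
  have hpoly : ∀ p q : ℝ, p ^ 4 * A x z x z + 2 * p ^ 3 * q * (A x z x w + A x z y z) +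
      p ^ 2 * q ^ 2 * (A x w x w + A y z y z + 2 * A x z y w + 2 * A x w y z) +
      2 * p * q ^ 3 * (A x w y w + A y z y w) + q ^ 4 * A y w y w = 0 := fun p q => by
    have hpq := h p q
    simp only [map_add, map_smul, LinearMap.add_apply, LinearMap.smul_apply, smul_eq_mul,
      hA.pair x w x z, hA.pair y z x z, hA.pair y w x z, hA.pair y w x w, hA.pair y w y z,
      hA.pair y z x w] at hpq
    linear_combination hpq
  have h10 := hpoly 1 0
  have h01 := hpoly 0 1
  have h11 := hpoly 1 1
  have h1n := hpoly 1 (-1)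
  have h12 := hpoly 1 2
  refine ⟨?_, ?_, ?_, ?_, ?_⟩ <;> linarith

namespace Model.IsNullJordanOsserman

variable [FiniteDimensional ℝ V] {M : Model V} {b : Fin 4 → V}

theorem trace_jacobi (h : M.IsNullJordanOsserman) {v : V} (hv : v ∈ M.nullCone) :
    LinearMap.trace ℝ V (M.jacobi v) = 0 := by
  have h2 : (2 : ℝ) • v ∈ M.nullCone := ⟨by simpa using hv.1, by simp [hv.2]⟩
  have := (h v hv _ h2).trace_eq
  rw [jacobi_smul, map_smul, smul_eq_mul] at this
  linarith

theorem trace_jacobi_comp_self (h : M.IsNullJordanOsserman) {v : V} (hv : v ∈ M.nullCone) :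
    LinearMap.trace ℝ V (M.jacobi v ∘ₗ M.jacobi v) = 0 := by
  have h2 : (2 : ℝ) • v ∈ M.nullCone := ⟨by simpa using hv.1, by simp [hv.2]⟩
  have := (h v hv _ h2).comp_self.trace_eq
  rw [jacobi_smul, LinearMap.comp_smul, LinearMap.smul_comp, map_smul, map_smul, smul_eq_mul,
    smul_eq_mul] at this
  linarith

theorem exists_ricci_eq_mul_form (h : M.IsNullJordanOsserman) (hdim : finrank ℝ V = 4)
    (hb : IsNullFrame M.form b) :
    ∃ c : ℝ, ∀ x y, ∑ i, M.curv (b i) x y (dualFrame b i) = c * M.form x y := by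
  have hA := M.curv_isCurvature
  let ricci : LinearMap.BilinForm ℝ V :=
    ∑ i, (M.curv (b i)).compr₂ (LinearMap.applyₗ (dualFrame b i))
  have hricci : ∀ x y, ricci x y = ∑ i, M.curv (b i) x y (dualFrame b i) := fun x y => by
    simp [ricci]
  have hsymm : ricci.IsSymm := ⟨fun x y => by
    simp only [hricci, Fin.sum_univ_four, dualFrame, cons_val, map_neg]
    rw [hA.reverse (b 0) y, hA.reverse (b 1) y, hA.reverse (b 2) y, hA.reverse (b 3) y]
    ring⟩
  obtain ⟨c, hc⟩ := hb.exists_eq_smul_of_forall_null hdim hsymm fun v hv => by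
    rcases eq_or_ne v 0 with rfl | hv0
    · simp
    · rw [hricci, ← h.trace_jacobi ⟨hv0, hv⟩, hb.trace_eq_sum hdim]
      simp only [form_jacobi]
  exact ⟨c, fun x y => by rw [← hricci, hc, LinearMap.smul_apply, LinearMap.smul_apply,
    smul_eq_mul]⟩

theorem curv_mul_curv_eq_zero (h : M.IsNullJordanOsserman) (hdim : finrank ℝ V = 4)
    (hb : IsNullFrame M.form b) :
    M.curv (b 0) (b 1) (b 0) (b 1) * M.curv (b 0) (b 2) (b 0) (b 2) = 0 := by
  have hA := M.curv_isCurvature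
  have hv : b 0 ∈ M.nullCone := ⟨hb.linearIndependent.ne_zero 0, by simp [hb _ _]⟩
  set J := M.jacobi (b 0)
  have hself : ∀ y z, M.form (J y) z = M.form y (J z) := fun y z => by
    rw [← M.form_symm.eq (J z), form_jacobi, form_jacobi, hA.reverse]
  have hJ0 : J (b 0) = 0 :=
    M.form_nondegenerate.1 _ fun z => by rw [form_jacobi, hA.self_left]
  have h0 : ∀ y, M.form (J y) (b 0) = 0 := fun y => by rw [hself, hJ0, map_zero]
  have hdiag : ∀ y, M.form (J y) y = -M.curv (b 0) y (b 0) y := fun y => by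
    rw [form_jacobi, hA.skew]
  have h12 : M.form (J (b 1)) (b 2) = 0 := by
    have := h.trace_jacobi hv
    simp only [hb.trace_eq_sum hdim, Fin.sum_univ_four, dualFrame, cons_val, map_neg] at this
    rw [hJ0, LinearMap.map_zero₂, h0, hself (b 2), ← M.form_symm.eq (J (b 1))] at this
    linarith
  have hJ12 : M.form (J (b 1)) (J (b 2)) =
      -(M.curv (b 0) (b 1) (b 0) (b 1) * M.curv (b 0) (b 2) (b 0) (b 2)) := by
    rw [hb.form_eq_sum hdim]
    simp only [Fin.sum_univ_four, dualFrame, cons_val, map_neg]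
    rw [← hself (b 0), ← hself (b 2), hJ0, h12, h0, LinearMap.map_zero₂, hdiag, hdiag]
    ring
  have := h.trace_jacobi_comp_self hv
  simp only [hb.trace_eq_sum hdim, Fin.sum_univ_four, dualFrame, cons_val, map_neg,
    LinearMap.comp_apply] at this
  rw [hJ0, map_zero, LinearMap.map_zero₂, h0, hself (J (b 1)), hself (J (b 2)),
    ← M.form_symm.eq (J (b 1)), hJ12] at this
  linarith

theorem exists_isNullFrame_curv_eq_zero (h : M.IsNullJordanOsserman) (hdim : finrank ℝ V = 4)
    (hb : IsNullFrame M.form b) :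
    ∃ b, IsNullFrame M.form b ∧ ∀ α γ : ℝ, M.curv (α • b 0 + γ • b 1) (α • b 2 + γ • b 3)
      (α • b 0 + γ • b 1) (α • b 2 + γ • b 3) = 0 := by
  have hA := M.curv_isCurvature
  by_cases hW : ∀ α γ : ℝ, M.curv (α • b 0 + γ • b 1) (α • b 2 + γ • b 3)
      (α • b 0 + γ • b 1) (α • b 2 + γ • b 3) = 0
  · exact ⟨b, hb, hW⟩
  refine ⟨![b 0, b 2, b 1, b 3], hb.swap, fun α γ => ?_⟩
  push Not at hW
  obtain ⟨p, q, hpq⟩ := hW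
  by_cases hαγ : α = 0 ∧ γ = 0
  · simp [hαγ]
  have hpq0 : ¬(p = 0 ∧ q = 0) := by
    rintro ⟨rfl, rfl⟩
    simp at hpq
  obtain ⟨β, δ, hdet⟩ := exists_mul_sub_mul_eq_one hαγ
  obtain ⟨r, s, hdet'⟩ := exists_mul_sub_mul_eq_one hpq0
  have key := h.curv_mul_curv_eq_zero hdim ((hb.rotate hdet).swap.rotate hdet')
  have hcomm : ∀ x y z w : ℝ, z • (x • b 0 + y • b 2) + w • (x • b 1 + y • b 3) =
      x • (z • b 0 + w • b 1) + y • (z • b 2 + w • b 3) := fun x y z w => by module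
  simp only [cons_val] at key
  rw [hA.apply_smul_add_smul, mul_comm q r, hdet', one_pow, one_mul, hcomm, hcomm,
    hA.apply_smul_add_smul, mul_comm γ β, hdet, one_pow, one_mul] at key
  exact (mul_eq_zero.1 key).resolve_left hpq

end Model.IsNullJordanOsserman

namespace IsNullFrame

variable {g : LinearMap.BilinForm ℝ V} {b : Fin 4 → V} {A : Tensor4 V}

theorem curv_components (h : IsNullFrame g b) (hA : IsAlgebraicCurvatureTensor A) {c : ℝ}
    (hric : ∀ x y, ∑ i, A (b i) x y (dualFrame b i) = c * g x y)
    (hW : ∀ p q : ℝ, A (p • b 0 + q • b 1) (p • b 2 + q • b 3) (p • b 0 + q • b 1)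
      (p • b 2 + q • b 3) = 0) :
    A (b 0) (b 1) (b 0) (b 2) = 0 ∧ A (b 0) (b 1) (b 1) (b 3) = 0 ∧
    A (b 0) (b 2) (b 0) (b 2) = 0 ∧ A (b 0) (b 2) (b 0) (b 3) = 0 ∧
    A (b 0) (b 2) (b 1) (b 2) = 0 ∧ A (b 0) (b 2) (b 2) (b 3) = 0 ∧
    A (b 0) (b 3) (b 1) (b 3) = 0 ∧ A (b 1) (b 2) (b 1) (b 3) = 0 ∧
    A (b 1) (b 3) (b 1) (b 3) = 0 ∧ A (b 1) (b 3) (b 2) (b 3) = 0 ∧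
    A (b 0) (b 1) (b 1) (b 2) = -A (b 0) (b 1) (b 0) (b 3) ∧
    A (b 1) (b 2) (b 2) (b 3) = -A (b 0) (b 3) (b 2) (b 3) ∧
    A (b 1) (b 2) (b 1) (b 2) = A (b 0) (b 3) (b 0) (b 3) ∧
    2 * A (b 0) (b 2) (b 1) (b 3) = A (b 0) (b 1) (b 2) (b 3) - A (b 0) (b 3) (b 0) (b 3) ∧
    2 * A (b 0) (b 3) (b 1) (b 2) = -A (b 0) (b 1) (b 2) (b 3) - A (b 0) (b 3) (b 0) (b 3) := by
  have hleft : ∀ i j k l, j < i → A (b i) (b j) (b k) (b l) = -A (b j) (b i) (b k) (b l) :=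
    fun i j k l _ => hA.skew _ _ _ _
  have hright : ∀ i j k l, l < k → A (b i) (b j) (b k) (b l) = -A (b i) (b j) (b l) (b k) :=
    fun i j k l _ => hA.skew_right _ _ _ _
  have hpair : ∀ i j k l, k < i ∨ k = i ∧ l < j →
      A (b i) (b j) (b k) (b l) = A (b k) (b l) (b i) (b j) := fun i j k l _ => hA.pair _ _ _ _
  have hbianchi := hA.bianchi (b 0) (b 1) (b 2) (b 3)
  obtain ⟨w0202, w02, w1313, w13, w0213⟩ := hA.coeff_eq_zero_of_forall_apply_eq_zero hW
  have hricci : ∀ i j, A (b 0) (b i) (b j) (b 3) - A (b 1) (b i) (b j) (b 2) -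
      A (b 2) (b i) (b j) (b 1) + A (b 3) (b i) (b j) (b 0) = c * g (b i) (b j) := fun i j => by
    rw [← hric, Fin.sum_univ_four]
    simp only [dualFrame, cons_val, map_neg]
    ring
  have r := And.intro (hricci 0 0) <| And.intro (hricci 0 1) <| And.intro (hricci 0 2) <|
    And.intro (hricci 0 3) <| And.intro (hricci 1 1) <| And.intro (hricci 1 2) <|
    And.intro (hricci 1 3) <| And.intro (hricci 2 2) <| And.intro (hricci 2 3) (hricci 3 3)
  simp only [hleft, hright, hpair, hA.self_left, hA.self_right, Fin.isValue, Fin.reduceLT,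
    Fin.reduceEq, zero_lt_one, zero_ne_one, lt_self_iff_false, and_self, and_true, or_true,
    or_false, h _ _, of_apply, cons_val', cons_val_fin_one, cons_val] at r hbianchi
  obtain ⟨r00, r01, r02, r03, r11, r12, r13, r22, r23, r33⟩ := r
  refine ⟨?_, ?_, ?_, ?_, ?_, ?_, ?_, ?_, ?_, ?_, ?_, ?_, ?_, ?_, ?_⟩ <;> linarith

theorem exists_quadCurv_para (h : IsNullFrame g b) (hdim : finrank ℝ V = 4) (hg : g.IsSymm)
    (hA : IsAlgebraicCurvatureTensor A) {c : ℝ}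
    (hric : ∀ x y, ∑ i, A (b i) x y (dualFrame b i) = c * g x y)
    (hW : ∀ p q : ℝ, A (p • b 0 + q • b 1) (p • b 2 + q • b 3) (p • b 0 + q • b 1)
      (p • b 2 + q • b 3) = 0) :
    ∃ m : Matrix (Fin 3) (Fin 3) ℝ, m.IsSymm ∧ A = quadCurv g m (h.para hdim) := by
  obtain ⟨h0102, h0113, h0202, h0203, h0212, h0223, h0313, h1213, h1313, h1323, h0112, h1223,
    h1212, h0213, h0312⟩ := h.curv_components hA hric hW
  generalize hx : A (b 0) (b 1) (b 0) (b 1) = x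
  generalize hy : A (b 0) (b 1) (b 0) (b 3) = y
  generalize hz : A (b 0) (b 1) (b 2) (b 3) = z
  generalize hw : A (b 0) (b 3) (b 0) (b 3) = w
  generalize hu : A (b 0) (b 3) (b 2) (b 3) = u
  generalize ht : A (b 2) (b 3) (b 2) (b 3) = t
  let m : Matrix (Fin 3) (Fin 3) ℝ := !![-(x + t) / 12 - (z - w / 3) / 4, (y + u) / 6, (t - x) / 12;
    (y + u) / 6, -w / 3, (y - u) / 6; (t - x) / 12, (y - u) / 6, -(x + t) / 12 + (z - w / 3) / 4]
  have hm : m.IsSymm := by ext i j; fin_cases i <;> fin_cases j <;> rfl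
  refine ⟨m, hm, hA.ext_of_basis (isAlgebraicCurvatureTensor_quadCurv hg hm
    (h.isCliffordTriple_para hdim).skew) (h.basis hdim) fun i j k l hij hkl hle => ?_⟩
  rw [coe_basis, quadCurv_apply]
  fin_cases i <;> fin_cases j <;> try (exact absurd hij (by decide))
  all_goals fin_cases k <;> fin_cases l <;> try (exact absurd hkl (by decide))
  all_goals try (exact absurd hle (by decide))
  all_goals
    simp only [Fin.sum_univ_three, para_apply, h _ _, m, of_apply, cons_val', cons_val_fin_one,
      cons_val, map_neg, LinearMap.neg_apply, Fin.isValue, Fin.zero_eta, Fin.mk_one,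
      Fin.reduceFinMk]
    linarith

end IsNullFrame

/-! ### Eigenvalues -/

namespace Model.IsNullJordanOsserman

variable [FiniteDimensional ℝ V] {M : Model V} {Ψ : Fin 3 → V →ₗ[ℝ] V}
  {m : Matrix (Fin 3) (Fin 3) ℝ}

theorem exists_curv_eq_quadCurv (h : M.IsNullJordanOsserman) (hdim : finrank ℝ V = 4)
    (hsig : M.HasSignature 2 2) :
    ∃ Ψ m, IsCliffordTriple M.form Ψ ∧ quadCurv M.form lorentz Ψ = (3 : ℝ) • constCurv M.form ∧
      m.IsSymm ∧ M.curv = quadCurv M.form m Ψ := by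
  obtain ⟨b₀, hb₀⟩ := hsig.exists_isNullFrame
  obtain ⟨b, hb, hW⟩ := h.exists_isNullFrame_curv_eq_zero hdim hb₀
  obtain ⟨c, hric⟩ := h.exists_ricci_eq_mul_form hdim hb
  obtain ⟨m, hm, hA⟩ :=
    hb.exists_quadCurv_para hdim M.form_symm M.curv_isCurvature hric hW
  exact ⟨hb.para hdim, m, hb.isCliffordTriple_para hdim,
    hb.quadCurv_lorentz_para hdim M.form_symm, hm, hA⟩

theorem isNullNondegenerate_or_forall_adjForm_eq_zero (h : M.IsNullJordanOsserman)
    (hdim : finrank ℝ V = 4) (hΨ : IsCliffordTriple M.form Ψ) (hm : m.IsSymm)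
    (hA : M.curv = quadCurv M.form m Ψ) :
    IsNullNondegenerate m ∨ ∀ n ≠ 0, lorentzNorm n = 0 → adjForm m n = 0 := by
  have : Nontrivial V := nontrivial_of_finrank_pos (R := ℝ) (by omega)
  have hker : ∀ {n}, n ≠ 0 → lorentzNorm n = 0 → ∃ v ∈ M.nullCone,
      (finrank ℝ (LinearMap.ker (M.jacobi v)) = 2 ↔ adjForm m n ≠ 0) := fun hn hnn => by
    obtain ⟨v, hv, hvv, hnv⟩ := hΨ.exists_apply_eq_zero hn hnn
    refine ⟨v, ⟨hv, hvv⟩, ?_⟩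
    rw [jacobi_quadCurv hm hΨ.skew hA, LinearMap.ker_smul _ _ three_ne_zero,
      hΨ.finrank_ker_quadOp_eq_two_iff M.form_symm M.form_nondegenerate hdim hv hvv hn hnv]
  rw [or_iff_not_imp_right]
  intro hne n hn hnn
  push Not at hne
  obtain ⟨n', hn', hnn', hadj'⟩ := hne
  obtain ⟨v, hv, hvn⟩ := hker hn hnn
  obtain ⟨v', hv', hvn'⟩ := hker hn' hnn'
  exact hvn.1 ((h v hv v' hv').finrank_ker_eq.trans (hvn'.2 hadj'))

theorem lorentzNorm_ne_zero [Nontrivial V] (h : M.IsNullJordanOsserman)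
    (hΨ : IsCliffordTriple M.form Ψ) {σ : ℝ} (hσ : σ ≠ 0) {l : Fin 3 → ℝ} (hl : l ≠ 0)
    (hA : M.curv = quadCurv M.form (σ • vecMulVec l l) Ψ) : lorentzNorm l ≠ 0 := by
  intro hnull
  have hJ : ∀ v y, M.jacobi v y = (3 * (σ * M.form (Fintype.linearCombination ℝ Ψ l v) y)) •
      Fintype.linearCombination ℝ Ψ l v := fun v y => by
    rw [jacobi_quadCurv (.smul (transpose_vecMulVec l l) σ) hΨ.skew hA, LinearMap.smul_apply,
      quadOp_smul_vecMulVec, linearCombination_apply, smul_smul]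
  obtain ⟨v, hv, hvv, hlv⟩ := hΨ.exists_apply_eq_zero hl hnull
  have hJv : M.jacobi v = 0 := by ext y; simp [hJ, hlv]
  have hvanish : ∀ w ∈ M.nullCone, Fintype.linearCombination ℝ Ψ l w = 0 := fun w hw => by
    obtain ⟨φ, hφ⟩ := h w hw v ⟨hv, hvv⟩
    by_contra hlw
    refine hlw (M.form_nondegenerate.1 _ fun y => ?_)
    have hy : M.jacobi w y = 0 := φ.map_eq_zero_iff.1 <| by
      simpa [hJv] using LinearMap.congr_fun hφ y
    simpa [hJ, hσ, hlw] using hy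
  have hl' : lorentz *ᵥ l ≠ 0 := fun h0 => hl (by
    rw [← lorentz_mulVec_lorentz_mulVec l, h0, mulVec_zero])
  obtain ⟨w, hw, hww, hlw⟩ := hΨ.exists_apply_eq_zero hl' (by
    rw [← dotProduct_lorentz_mulVec, lorentz_mulVec_lorentz_mulVec, dotProduct_comm,
      dotProduct_lorentz_mulVec, hnull])
  have hanti := LinearMap.congr_fun (hΨ.linearCombination_anticomm l (lorentz *ᵥ l)) w
  rw [lorentz_mulVec_lorentz_mulVec, LinearMap.add_apply, LinearMap.comp_apply,
    LinearMap.comp_apply, hlw, hvanish w ⟨hw, hww⟩, map_zero, map_zero, add_zero, eq_comm] at hanti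
  simp [hw, hl] at hanti

theorem isLorentzDiagonalizable (h : M.IsNullJordanOsserman) (hdim : finrank ℝ V = 4)
    (hΨ : IsCliffordTriple M.form Ψ) (hm : m.IsSymm) (hA : M.curv = quadCurv M.form m Ψ) :
    IsLorentzDiagonalizable m := by
  have : Nontrivial V := nontrivial_of_finrank_pos (R := ℝ) (by omega)
  rcases h.isNullNondegenerate_or_forall_adjForm_eq_zero hdim hΨ hm hA with hnd | hdeg
  · exact hnd.isLorentzDiagonalizable hm
  · obtain ⟨c, rfl⟩ | ⟨σ, l, rfl⟩ := eq_smul_lorentz_or_eq_smul_vecMulVec hm hdeg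
    · exact .smul_lorentz c
    · rcases eq_or_ne σ 0 with rfl | hσ
      · simpa using IsLorentzDiagonalizable.zero
      rcases eq_or_ne l 0 with rfl | hl
      · simpa using IsLorentzDiagonalizable.zero
      · exact .smul_vecMulVec σ (h.lorentzNorm_ne_zero hΨ hσ hl hA)

theorem exists_curv_eq_quadCurv_diagonal (h : M.IsNullJordanOsserman) (hdim : finrank ℝ V = 4)
    (hsig : M.HasSignature 2 2) :
    ∃ κ Ψ, IsCliffordTriple M.form Ψ ∧ quadCurv M.form lorentz Ψ = (3 : ℝ) • constCurv M.form ∧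
      M.curv = quadCurv M.form (diagonal κ) Ψ := by
  obtain ⟨Ψ, m, hΨ, hconst, hm, hA⟩ := h.exists_curv_eq_quadCurv hdim hsig
  obtain ⟨X, κ, hX, rfl⟩ := h.isLorentzDiagonalizable hdim hΨ hm hA
  exact ⟨κ, _, hΨ.congr hX, by rw [← quadCurv_congr, hX.transpose_mul_lorentz_mul, hconst],
    hA.trans (quadCurv_congr ..)⟩

theorem eigenvalue_cases (h : M.IsNullJordanOsserman) (hdim : finrank ℝ V = 4)
    (hΨ : IsCliffordTriple M.form Ψ) {κ : Fin 3 → ℝ}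
    (hA : M.curv = quadCurv M.form (diagonal κ) Ψ) :
    (κ 1 = -κ 0 ∧ κ 2 = -κ 0) ∨ (κ 1 = κ 2 ∧ κ 1 + κ 0 ≠ 0) ∨ (κ 0 = 0 ∧ κ 1 = 0 ∧ κ 2 ≠ 0) ∨
      (κ 0 = 0 ∧ κ 2 = 0 ∧ κ 1 ≠ 0) ∨
        (0 < κ 1 * κ 2 * (κ 1 + κ 0) * (κ 2 + κ 0) ∧
          κ 0 ≠ -κ 1 ∧ κ 0 ≠ -κ 2 ∧ κ 1 ≠ κ 2) := by
  rcases h.isNullNondegenerate_or_forall_adjForm_eq_zero hdim hΨ (isSymm_diagonal κ) hA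
    with hnd | hdeg
  · have hpos := isNullNondegenerate_diagonal_iff.1 hnd
    have h₁₀ : κ 1 + κ 0 ≠ 0 := fun h0 => by simp [h0] at hpos
    have h₂₀ : κ 2 + κ 0 ≠ 0 := fun h0 => by simp [h0] at hpos
    grind
  · have h₁ : κ 2 * (κ 1 + κ 0) = 0 := by
      rw [← hdeg ![1, 1, 0] (by simp) (by simp [lorentzNorm])]
      simp only [adjForm_diagonal, cons_val]
      ring
    have h₂ : κ 1 * (κ 2 + κ 0) = 0 := by
      rw [← hdeg ![1, 0, 1] (by simp) (by simp [lorentzNorm])]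
      simp only [adjForm_diagonal, cons_val]
      ring
    grind

end Model.IsNullJordanOsserman

end NullOsserman

theorem theorem1p3 {V : Type*} [AddCommGroup V] [Module ℝ V] [FiniteDimensional ℝ V]
    (hdim : Module.finrank ℝ V = 4)
    (M : NullOsserman.Model V) (hsig : M.HasSignature 2 2) :
    M.IsNullJordanOsserman ↔
      M.IsTypeIa ∧
        ((∃ κ₀ : ℝ, M.curv = κ₀ • NullOsserman.constCurv M.form) ∨
         (∃ (κ₀ κJ : ℝ) (J : V →ₗ[ℝ] V), κJ ≠ 0 ∧
            NullOsserman.IsOrthogonalComplex M.form J ∧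
            M.curv = κ₀ • NullOsserman.constCurv M.form + κJ • NullOsserman.endoCurv M.form J) ∨
         (∃ (κP : ℝ) (P : V →ₗ[ℝ] V), κP ≠ 0 ∧
            NullOsserman.IsAdaptedParacomplex M.form P ∧
            M.curv = κP • NullOsserman.endoCurv M.form P) ∨
         (∃ (κ₁ κ₂ κ₃ : ℝ) (Ψ₁ Ψ₂ Ψ₃ : V →ₗ[ℝ] V),
            κ₂ * κ₃ * (κ₂ + κ₁) * (κ₃ + κ₁) > 0 ∧
            (3 * κ₁ ≠ -3 * κ₂ ∧ 3 * κ₁ ≠ -3 * κ₃ ∧ -3 * κ₂ ≠ -3 * κ₃) ∧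
            NullOsserman.IsParaquaternionic M.form Ψ₁ Ψ₂ Ψ₃ ∧
            M.curv = κ₁ • NullOsserman.endoCurv M.form Ψ₁ +
              κ₂ • NullOsserman.endoCurv M.form Ψ₂ +
              κ₃ • NullOsserman.endoCurv M.form Ψ₃)) := by
  constructor
  · intro h
    obtain ⟨κ, Ψ, hΨ, hconst, hA⟩ := h.exists_curv_eq_quadCurv_diagonal hdim hsig
    refine ⟨hΨ.isTypeIa hdim hA, ?_⟩
    have hcases := h.eigenvalue_cases hdim hΨ hA
    have hpq := hΨ.isParaquaternionic
    rw [NullOsserman.quadCurv_lorentz] at hconst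
    rw [NullOsserman.quadCurv_diagonal, Fin.sum_univ_three] at hA
    rcases hcases with ⟨h₁, h₂⟩ | ⟨h₁₂, h₀⟩ | ⟨h₀, h₁, h₂⟩ | ⟨h₀, h₂, h₁⟩ | ⟨hpos, hne⟩
    · exact .inl ⟨κ 0 * 3, by rw [hA, h₁, h₂, mul_smul, ← hconst]; module⟩
    · exact .inr <| .inl ⟨-κ 1 * 3, κ 1 + κ 0, Ψ 0, h₀, hpq.complex₁, by
        rw [hA, ← h₁₂, mul_smul, ← hconst]; module⟩
    · exact .inr <| .inr <| .inl ⟨κ 2, Ψ 2, h₂, hpq.para₃, by rw [hA, h₀, h₁]; module⟩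
    · exact .inr <| .inr <| .inl ⟨κ 1, Ψ 1, h₁, hpq.para₂, by rw [hA, h₀, h₂]; module⟩
    · exact .inr <| .inr <| .inr ⟨κ 0, κ 1, κ 2, Ψ 0, Ψ 1, Ψ 2, hpos, by grind, hpq, hA⟩
  · rintro ⟨-, ⟨κ₀, hA⟩ | ⟨κ₀, κJ, J, -, hJ, hA⟩ | ⟨κP, P, -, hP, hA⟩ |
      ⟨κ₁, κ₂, κ₃, Ψ₁, Ψ₂, Ψ₃, hκ, -, hΨ, hA⟩⟩
    · exact NullOsserman.Model.isNullJordanOsserman_of_curv_eq_smul_constCurv hA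
    · exact NullOsserman.Model.isNullJordanOsserman_of_curv_eq_add_isOrthogonalComplex hJ hA
    · exact NullOsserman.Model.isNullJordanOsserman_of_curv_eq_smul_isAdaptedParacomplex hP hA
    · exact hΨ.isCliffordTriple.isNullJordanOsserman hdim
        (Matrix.isSymm_diagonal ![κ₁, κ₂, κ₃])
        (by simp [hA, NullOsserman.quadCurv_diagonal, Fin.sum_univ_three])
        (NullOsserman.isNullNondegenerate_diagonal_iff.2 hκ)
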